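/- Let $G$ be a group. A left-preorder on $G$ is a reflexive, transitive, total relation $\preceq$ on $G$ that is left-invariant ($a\preceq b$ implies $ga\preceq gb$ for all $g,a,b\in G$) and non-trivial (not all pairs are related); write $a\prec b$ if $a\preceq b$ and $b\not\preceq a$. For a subgroup $C$ of $G$, the left-preorder $\preceq$ is relative to $C$ if $C=\{g\in G : 1\preceq g\text{ and } g\preceq 1\}$. It is conradian if for all $a,b\in G$ with $1\prec a$ and $1\prec b$ there is an integer $n\ge 0$ with $a\prec ba^n$. Let $\mathrm{Cord}_C(G)$ be the set of conradian left-preorders on $G$ relative to $C$. Identify each left-preorder $\preceq$ with the map $G\to\{1,-1,0\}$ that sends $g$ to $1$ if $1\prec g$, to $-1$ if $1\prec g^{-1}$, and to $0$ otherwise, and give $\mathrm{Cord}_C(G)$ the subspace topology of $\{1,-1,0\}^G$, where $\{1,-1,0\}$ is discrete and $\{1,-1,0\}^G$ has the product topology. Let $C$ be a proper subgroup of $G$. Then $\mathrm{Cord}_C(G)$ is either finite or uncountable. Moreover, if $\mathrm{Cord}_C(G)$ is infinite, then it is a non-empty compact Hausdorff space with no isolated points. -/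

import Mathlib

/-- A left-preorder on a group `G`: a total, transitive, reflexive, left-invariant and
non-trivial binary relation on `G`. -/
@[ext]
structure LeftPreorder (G : Type*) [Group G] where
  /-- the relation itself -/
  le : G → G → Prop
  refl : ∀ a, le a a
  trans : ∀ a b c, le a b → le b c → le a c
  total : ∀ a b, le a b ∨ le b a
  left_invariant : ∀ g a b, le a b → le (g * a) (g * b)
  nontrivial : ¬ ∀ a b, le a b

namespace LeftPreorder

variable {G : Type*} [Group G]

/-- The strict relation of a left-preorder. -/
def lt (r : LeftPreorder G) (a b : G) : Prop := r.le a b ∧ ¬ r.le b a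

/-- The left-preorder `r` is relative to the subgroup `C`: the class of `1`, that is
`{g | 1 ≼ g ≼ 1}`, is equal to `C`. -/
def IsRelativeTo (r : LeftPreorder G) (C : Subgroup G) : Prop :=
  {g : G | r.le 1 g ∧ r.le g 1} = (C : Set G)

/-- A left-preorder is conradian if for all positive `a`, `b` there is `n` with `a ≺ b * a ^ n`. -/
def IsConradian (r : LeftPreorder G) : Prop :=
  ∀ a b : G, r.lt 1 a → r.lt 1 b → ∃ n : ℕ, r.lt a (b * a ^ n)

/-- The positive cone `P` of a left-preorder. -/
def positiveCone (r : LeftPreorder G) : Set G := {g | r.lt 1 g}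

open Classical in
/-- The element of `{1, -1, 0}^G` attached to a left-preorder with positive cone `P`:
it is `1` on `P`, `-1` on `P⁻¹`, and `0` elsewhere. -/
noncomputable def signMap (r : LeftPreorder G) (g : G) : SignType :=
  if g ∈ r.positiveCone then 1 else if g⁻¹ ∈ r.positiveCone then -1 else 0

theorem signMap_eq_one_iff (r : LeftPreorder G) (g : G) :
    r.signMap g = 1 ↔ r.lt 1 g := by
  unfold signMap positiveCone
  by_cases h : r.lt 1 g
  · simp [h]
  · by_cases h2 : r.lt 1 g⁻¹ <;> simp [h, h2]

theorem le_iff_not_lt (r : LeftPreorder G) (a b : G) : r.le a b ↔ ¬ r.lt 1 (b⁻¹ * a) := by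
  have key : r.lt 1 (b⁻¹ * a) ↔ r.lt b a := by
    constructor
    · rintro ⟨h1, h2⟩
      refine ⟨by simpa using r.left_invariant b _ _ h1, fun h => h2 ?_⟩
      simpa using r.left_invariant b⁻¹ _ _ h
    · rintro ⟨h1, h2⟩
      refine ⟨by simpa using r.left_invariant b⁻¹ _ _ h1, fun h => h2 ?_⟩
      simpa using r.left_invariant b _ _ h
  rw [key]
  exact ⟨fun h h' => h'.2 h, fun h => by
    by_contra hn
    exact h ⟨(r.total a b).resolve_left hn, hn⟩⟩

/-- A left-preorder is determined by its element of `{1, -1, 0}^G`, so that the set of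
left-preorders is identified with a subset of `{1, -1, 0}^G`. -/
theorem signMap_injective :
    Function.Injective (signMap : LeftPreorder G → G → SignType) := by
  intro r s h
  ext a b
  rw [le_iff_not_lt, le_iff_not_lt, ← signMap_eq_one_iff, ← signMap_eq_one_iff, h]

/-- The topology on left-preorders given by the identification with a subset of `{1, -1, 0}^G`,
where `{1, -1, 0}` is discrete and the power has the product topology. -/
noncomputable instance : TopologicalSpace (LeftPreorder G) :=
  TopologicalSpace.induced signMap Pi.topologicalSpace

end LeftPreorder

/-- The set of conradian left-preorders on `G` relative to `C`; as a type it carries the subspace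
topology. -/
def Cord {G : Type*} [Group G] (C : Subgroup G) : Set (LeftPreorder G) :=
  {r | r.IsRelativeTo C ∧ r.IsConradian}

/-! It suffices that one isolated point forces `Cord C` to be finite. The Conradian condition is
equivalent to its case `n = 2`, hence closed, so `Cord C` is compact Hausdorff; if infinite it then
has no isolated points, and Baire's theorem makes it uncountable.

By Conrad's theorem (`exists_isLevel`), each positive `g` lies in a convex subgroup `E` with an
order-preserving homomorphism `τ : E → ℝ`, `τ g > 0`: a level. Conversely, replacing `τ` by another
homomorphism `σ` that vanishes on `C`, with the old order breaking ties, gives a new element of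
`Cord C` (`exists_modification`).

Let `r` be isolated, i.e. determined by the positivity of a finite set `T`. Modifications that keep
`T` positive must return `r`. Taking `σ = -τ` shows that `T` meets every level; taking `σ = τ + ε θ`
shows that each `E / ker τ` has rational rank one (`exists_commensurable`) and that `ker τ` is
negligible for every `s` in `Cord C` (`lt_of_mem_ker`). So each `r`-positive `x` has, under every
`s`, the sign of some `t ∈ T` (`exists_one_lt_iff`), and `s` is determined by its signs on `T`. -/

/-! ### Hölder's theorem for bi-invariant total preorders. -/

section Holder

variable {E : Type*} [Group E] [Preorder E] [MulLeftMono E]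

theorem zpow_le_zpow_of_one_le {g : E} (hg : 1 ≤ g) {m n : ℤ} (h : m ≤ n) : g ^ m ≤ g ^ n := by
  obtain ⟨k, rfl⟩ := Int.le.dest h
  rw [zpow_add, zpow_natCast]
  exact le_mul_of_one_le_right' (one_le_pow_of_one_le' hg k)

theorem le_of_zpow_le_zpow {g : E} (hg : 1 < g) {m n : ℤ} (h : g ^ m ≤ g ^ n) : m ≤ n := by
  by_contra! hlt
  have h1 : g ^ (n + 1) ≤ g ^ n := (zpow_le_zpow_of_one_le hg.le hlt).trans h
  have h2 : g ^ n * g ≤ g ^ n * 1 := by simpa [zpow_add] using h1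
  exact hg.not_ge (le_of_mul_le_mul_left' h2)

/-- This `k` is the integer part of `x` measured in powers of `g`. -/
theorem exists_zpow_le_and_le {g : E} (total : ∀ a b : E, a ≤ b ∨ b ≤ a) (hg : 1 < g)
    (cofinal : ∀ x : E, ∃ n : ℕ, x ≤ g ^ n) (coinitial : ∀ x : E, ∃ n : ℤ, g ^ n ≤ x) (x : E) :
    ∃ k : ℤ, (∀ z, g ^ z ≤ x ↔ z ≤ k) ∧ x ≤ g ^ (k + 1) := by
  obtain ⟨n, hn⟩ := cofinal x
  obtain ⟨k, hk, hmax⟩ := Int.exists_greatest_of_bdd (P := fun z => g ^ z ≤ x)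
    ⟨n, fun z hz => le_of_zpow_le_zpow hg (by simpa using hz.trans hn)⟩ (coinitial x)
  refine ⟨k, fun z => ⟨hmax z, fun h => (zpow_le_zpow_of_one_le hg.le h).trans hk⟩, ?_⟩
  refine (total _ _).resolve_right fun h => ?_
  have := hmax _ h
  omega

variable [MulRightMono E]

/-- A substitute for commutativity: if `x * y ≤ y * x`, each exchange of adjacent factors changes
the product in a known direction, so the two sorted words bound `(x * y) ^ n`. -/
theorem mul_pow_between (total : ∀ a b : E, a ≤ b ∨ b ≤ a) (x y : E) (n : ℕ) :
    (x ^ n * y ^ n ≤ (x * y) ^ n ∧ (x * y) ^ n ≤ y ^ n * x ^ n) ∨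
      (y ^ n * x ^ n ≤ (x * y) ^ n ∧ (x * y) ^ n ≤ x ^ n * y ^ n) := by
  have shift : ∀ (a b : E) (k : ℕ), (a * b) ^ (k + 1) = a * (b * a) ^ k * b := by
    intro a b k
    induction k with
    | zero => simp
    | succ k ih => rw [pow_succ, ih, pow_succ (b * a)]; simp only [mul_assoc]
  have split : ∀ (a b : E) (k : ℕ), a ^ (k + 1) * b ^ (k + 1) = a * (a ^ k * b ^ k) * b := by
    intro a b k
    rw [pow_succ' a, pow_succ b]
    simp only [mul_assoc]
  rcases total (x * y) (y * x) with h | h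
  · left
    induction n with
    | zero => simp
    | succ n ih =>
      rw [split, split]
      constructor
      · rw [shift]
        gcongr ?_ * y
        gcongr x * ?_
        exact ih.1.trans (pow_le_pow_left' h n)
      · refine (pow_le_pow_left' h _).trans ?_
        rw [shift]
        gcongr ?_ * x
        gcongr y * ?_
        exact ih.2
  · right
    induction n with
    | zero => simp
    | succ n ih =>
      rw [split, split]
      constructor
      · refine le_trans ?_ (pow_le_pow_left' h _)
        rw [shift]
        gcongr ?_ * x
        gcongr y * ?_
        exact ih.1
      · rw [shift]
        gcongr ?_ * y
        gcongr x * ?_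
        exact (pow_le_pow_left' h n).trans ih.2

/-- Hölder's theorem for bi-invariant total preorders. -/
theorem exists_monotone_additive_of_cofinal (total : ∀ a b : E, a ≤ b ∨ b ≤ a) {g : E}
    (hg : 1 < g) (cofinal : ∀ x : E, ∃ n : ℕ, x ≤ g ^ n) :
    ∃ τ : E → ℝ, (∀ x y, τ (x * y) = τ x + τ y) ∧ Monotone τ ∧ 0 < τ g := by
  have coinitial : ∀ x : E, ∃ n : ℤ, g ^ n ≤ x := by
    intro x
    obtain ⟨n, hn⟩ := cofinal x⁻¹
    refine ⟨-n, ?_⟩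
    have h : x * x⁻¹ * g ^ (-(n : ℤ)) ≤ x * g ^ n * g ^ (-(n : ℤ)) := by gcongr
    simpa using h
  choose f hf hf' using exists_zpow_le_and_le total hg cofinal coinitial
  have hfself : ∀ x, g ^ f x ≤ x := fun x => (hf x _).2 le_rfl
  have fmono : ∀ {x y}, x ≤ y → f x ≤ f y := fun {x y} h => (hf y _).1 ((hfself x).trans h)
  have fle : ∀ {x k}, x ≤ g ^ k → f x ≤ k := fun {x k} h =>
    le_of_zpow_le_zpow hg ((hfself x).trans h)
  have fsuper : ∀ x y, f x + f y ≤ f (x * y) := fun x y => by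
    rw [← hf, zpow_add]
    exact mul_le_mul' (hfself x) (hfself y)
  have fsub : ∀ x y, f (x * y) ≤ f x + f y + 2 := fun x y => by
    refine fle ((mul_le_mul' (hf' x) (hf' y)).trans (le_of_eq ?_))
    rw [← zpow_add]
    congr 1
    ring
  have fpow : ∀ x (n : ℕ), f (x ^ n) ≤ (f x + 1) * n := fun x n => by
    refine fle ((pow_le_pow_left' (hf' x) n).trans (le_of_eq ?_))
    rw [zpow_mul, zpow_natCast]
  have key : ∀ x, ∃ t : ℝ, Filter.Tendsto (fun n : ℕ => (f (x ^ n) : ℝ) / n) Filter.atTop (nhds t) := by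
    intro x
    -- Fekete's lemma, applied to the negative of the superadditive sequence `f (x ^ n)`.
    have hsub : Subadditive fun n : ℕ => -(f (x ^ n) : ℝ) := by
      intro m n
      have := fsuper (x ^ m) (x ^ n)
      rw [← pow_add] at this
      have : (f (x ^ m) : ℝ) + f (x ^ n) ≤ f (x ^ (m + n)) := by exact_mod_cast this
      linarith
    have hbdd : BddBelow (Set.range fun n : ℕ => -(f (x ^ n) : ℝ) / n) := by
      -- The absolute value covers `n = 0`, where the quotient is `0` by convention.
      refine ⟨-|(f x : ℝ) + 1|, ?_⟩
      rintro _ ⟨n, rfl⟩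
      rcases Nat.eq_zero_or_pos n with rfl | hn
      · simp
      · have hn' : (0 : ℝ) < n := by exact_mod_cast hn
        have h : (f (x ^ n) : ℝ) ≤ (f x + 1) * n := by exact_mod_cast fpow x n
        change -|(f x : ℝ) + 1| ≤ -(f (x ^ n) : ℝ) / n
        rw [le_div_iff₀ hn']
        nlinarith [le_abs_self ((f x : ℝ) + 1)]
    refine ⟨-hsub.lim, ?_⟩
    have := (hsub.tendsto_lim hbdd).neg
    simpa [neg_div] using this
  choose τ hτ using key
  refine ⟨τ, fun x y => ?_, fun x y h => ?_, ?_⟩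
  · have h0 : Filter.Tendsto (fun n : ℕ => (2 : ℝ) / n) Filter.atTop (nhds 0) :=
      tendsto_const_div_atTop_nhds_zero_nat 2
    have hlow := (hτ x).add (hτ y)
    have hup := hlow.add h0
    rw [add_zero] at hup
    -- The defect is bounded independently of `n`, so it vanishes after division by `n`.
    have hbd : ∀ n : ℕ, f (x ^ n) + f (y ^ n) ≤ f ((x * y) ^ n) ∧
        f ((x * y) ^ n) ≤ f (x ^ n) + f (y ^ n) + 2 := by
      intro n
      have h1 := fsuper (x ^ n) (y ^ n)
      have h2 := fsuper (y ^ n) (x ^ n)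
      have h3 := fsub (x ^ n) (y ^ n)
      have h4 := fsub (y ^ n) (x ^ n)
      rcases mul_pow_between total x y n with ⟨h, h'⟩ | ⟨h, h'⟩ <;>
        · have := fmono h
          have := fmono h'
          omega
    refine tendsto_nhds_unique (hτ (x * y)) (tendsto_of_tendsto_of_tendsto_of_le_of_le hlow hup ?_ ?_)
    · intro n
      have h : (f (x ^ n) : ℝ) + f (y ^ n) ≤ f ((x * y) ^ n) := by exact_mod_cast (hbd n).1
      change (f (x ^ n) : ℝ) / n + f (y ^ n) / n ≤ f ((x * y) ^ n) / n
      rw [← add_div]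
      gcongr
    · intro n
      have h : (f ((x * y) ^ n) : ℝ) ≤ f (x ^ n) + f (y ^ n) + 2 := by exact_mod_cast (hbd n).2
      change (f ((x * y) ^ n) : ℝ) / n ≤ (f (x ^ n) : ℝ) / n + f (y ^ n) / n + 2 / n
      rw [← add_div, ← add_div]
      gcongr
  · refine le_of_tendsto_of_tendsto' (hτ x) (hτ y) fun n => ?_
    have : (f (x ^ n) : ℝ) ≤ f (y ^ n) := by exact_mod_cast fmono (pow_le_pow_left' h n)
    gcongr
  · refine zero_lt_one.trans_le (ge_of_tendsto (hτ g) ?_)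
    filter_upwards [Filter.eventually_gt_atTop 0] with n hn
    have hn' : (0 : ℝ) < n := by exact_mod_cast hn
    rw [le_div_iff₀ hn', one_mul]
    exact_mod_cast (hf (g ^ n) n).1 (by simp)

/-- Hölder's theorem for a relation that is a bi-invariant total preorder. -/
theorem exists_additive_of_cofinal {E : Type*} [Group E] (le : E → E → Prop)
    (total : ∀ a b, le a b ∨ le b a) (trans : ∀ a b c, le a b → le b c → le a c)
    (mul_left : ∀ c a b, le a b → le (c * a) (c * b))
    (mul_right : ∀ c a b, le a b → le (a * c) (b * c)) {g : E} (hg : ¬ le g 1)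
    (cofinal : ∀ x : E, ∃ n : ℕ, le x (g ^ n)) :
    ∃ τ : E → ℝ, (∀ x y, τ (x * y) = τ x + τ y) ∧ (∀ x, le 1 x → 0 ≤ τ x) ∧ 0 < τ g := by
  let _ : Preorder E :=
    { le := le
      le_refl := fun a => (total a a).elim id id
      le_trans := trans }
  have : MulLeftMono E := ⟨fun c a b => mul_left c a b⟩
  have : MulRightMono E := ⟨fun c a b => mul_right c a b⟩
  obtain ⟨τ, hmul, hmono, hpos⟩ := exists_monotone_additive_of_cofinal (E := E) total
    (lt_of_le_not_ge ((total 1 g).resolve_right hg) hg) cofinal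
  have h1 : τ 1 = 0 := by simpa using hmul 1 1
  exact ⟨τ, hmul, fun x hx => h1 ▸ hmono hx, hpos⟩

end Holder

/-! ### Conrad's theorem for Conradian preorders. -/

section Conrad

/-- A left-invariant total preorder in which all positive `a`, `b` satisfy `a < b * a ^ n` for
some `n`. -/
structure IsConradianOrder (G : Type*) [Group G] [Preorder G] : Prop where
  total : ∀ a b : G, a ≤ b ∨ b ≤ a
  exists_lt : ∀ a b : G, 1 < a → 1 < b → ∃ n : ℕ, a < b * a ^ n

/-- The elements lying between two powers of `h`. -/
def IsDominatedBy {G : Type*} [Group G] [Preorder G] (h x : G) : Prop :=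
  (∃ n : ℕ, x ≤ h ^ n) ∧ ∃ n : ℕ, x⁻¹ ≤ h ^ n

variable {G : Type*} [Group G] [Preorder G]

theorem mulLeftStrictMono_of_mulLeftMono [MulLeftMono G] : MulLeftStrictMono G :=
  ⟨fun c _ _ h => lt_of_le_not_ge (mul_le_mul_right h.le c)
    fun h' => h.not_ge (le_of_mul_le_mul_left' h')⟩

theorem isDominatedBy_of_le [MulLeftMono G] {x y : G} (hx : 1 ≤ x) (hxy : x ≤ y) :
    IsDominatedBy y x :=
  ⟨⟨1, by simpa using hxy⟩, 0, by simpa using hx⟩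

namespace IsConradianOrder

theorem lt_of_not_ge (hG : IsConradianOrder G) {a b : G} (h : ¬ a ≤ b) : b < a :=
  lt_of_le_not_ge ((hG.total b a).resolve_right h) h

variable [MulLeftMono G] [MulLeftStrictMono G]

/-- The exponent `2` always suffices. If `f * g ^ 2 ≤ g`, then `h = f * g` satisfies `h ^ n * g ≤ g`
for all `n`, whence `f * h ^ n ≤ h` for all `n`, against the Conradian condition for `h` and `f`. -/
theorem lt_mul_sq (hG : IsConradianOrder G) {f g : G} (hf : 1 < f) (hg : 1 < g) :
    g < f * g ^ 2 := by
  refine hG.lt_of_not_ge fun hle => ?_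
  have hh : 1 < f * g := hf.trans (lt_mul_of_one_lt_right' f hg)
  have h1 : (f * g) * g ≤ g := by simpa [pow_two, mul_assoc] using hle
  have h2 : ∀ n : ℕ, (f * g) ^ n * g ≤ g := by
    intro n
    induction n with
    | zero => simp
    | succ n ih =>
      rw [pow_succ, mul_assoc]
      exact (mul_le_mul_right h1 _).trans ih
  obtain ⟨n, hn⟩ := hG.exists_lt _ _ hh hf
  refine hn.not_ge ?_
  cases n with
  | zero => simpa using (lt_mul_of_one_lt_right' f hg).le
  | succ n =>
    rw [pow_succ]
    calc f * ((f * g) ^ n * (f * g)) ≤ f * ((f * g) ^ n * ((f * g) * g)) := by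
          gcongr f * ((f * g) ^ n * ?_)
          exact (lt_mul_of_one_lt_right' _ hg).le
      _ ≤ f * ((f * g) ^ n * g) := by gcongr f * ((f * g) ^ n * ?_)
      _ ≤ f * g := by gcongr f * ?_; exact h2 n

theorem lt_mul_pow_three (hG : IsConradianOrder G) {v g : G} (hv : 1 ≤ v) (hg : 1 < g) :
    g < v * g ^ 3 := by
  have := hG.lt_mul_sq (f := v * g) (hv.trans_lt (lt_mul_of_one_lt_right' v hg)) hg
  rwa [mul_assoc, ← pow_succ'] at this

theorem exists_mul_pow_le (hG : IsConradianOrder G) {h x : G} (hh : 1 < h) {n : ℕ}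
    (hx : x ≤ h ^ n) (k : ℕ) : ∃ m : ℕ, x * h ^ k ≤ h ^ m := by
  set N := n + k + 1
  have hxN : x ≤ h ^ N := hx.trans (pow_le_pow_right' hh.le (by omega))
  have h1 : 1 ≤ x⁻¹ * h ^ N := by rwa [le_inv_mul_iff_mul_le, mul_one]
  have h2 := hG.lt_mul_pow_three h1 (one_lt_pow' hh (by omega : N ≠ 0))
  have h3 : x * h ^ N ≤ h ^ (N + N * 3) := by
    have := mul_le_mul_right h2.le x
    rwa [mul_assoc, mul_inv_cancel_left, ← pow_mul, ← pow_add] at this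
  exact ⟨_, (mul_le_mul_right (pow_le_pow_right' hh.le (by omega)) x).trans h3⟩

/-- The convex subgroup of the elements lying between two powers of `h`. -/
def dominatedSubgroup (hG : IsConradianOrder G) {h : G} (hh : 1 < h) : Subgroup G where
  carrier := {x | IsDominatedBy h x}
  one_mem' := ⟨⟨0, by simp⟩, 0, by simp⟩
  inv_mem' := fun {x} hx => ⟨hx.2, by simpa using hx.1⟩
  mul_mem' := by
    rintro x y ⟨⟨a, ha⟩, b, hb⟩ ⟨⟨c, hc⟩, d, hd⟩
    obtain ⟨m, hm⟩ := hG.exists_mul_pow_le hh ha c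
    obtain ⟨k, hk⟩ := hG.exists_mul_pow_le hh hd b
    refine ⟨⟨m, (mul_le_mul_right hc x).trans hm⟩, k, ?_⟩
    rw [mul_inv_rev]
    exact (mul_le_mul_right hb _).trans hk

theorem isDominatedBy_trans (hG : IsConradianOrder G) {x y z : G} (hz : 1 < z)
    (hzy : IsDominatedBy z y) (hyx : IsDominatedBy y x) : IsDominatedBy z x := by
  have key : ∀ n : ℕ, ∃ m : ℕ, y ^ n ≤ z ^ m := fun n =>
    ((hG.dominatedSubgroup hz).pow_mem (x := y) hzy n).1
  obtain ⟨⟨a, ha⟩, b, hb⟩ := hyx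
  obtain ⟨c, hc⟩ := key a
  obtain ⟨d, hd⟩ := key b
  exact ⟨⟨c, ha.trans hc⟩, d, hb.trans hd⟩

theorem exists_one_le_pow_mul (hG : IsConradianOrder G) {h x : G} (hh : 1 < h)
    (hx : IsDominatedBy h x) : ∃ m : ℕ, 1 ≤ h ^ m * x := by
  by_contra! hcon
  obtain ⟨n, hn⟩ := hx.2
  -- The exponent is twice `n + 1` so that `lt_mul_sq` for `h ^ (n + 1)` cancels it and leaves `h ^
  -- (n + 1) < x⁻¹ ≤ h ^ n`.
  have h1 : 1 < x⁻¹ * (h ^ (2 * (n + 1)))⁻¹ := by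
    have := hG.lt_of_not_ge (hcon (2 * (n + 1)))
    rw [← mul_inv_rev]
    exact Left.one_lt_inv_iff.2 this
  have h2 := hG.lt_mul_sq h1 (one_lt_pow' hh (Nat.succ_ne_zero n))
  rw [← pow_mul, mul_comm (n + 1) 2, inv_mul_cancel_right] at h2
  exact (h2.trans_le hn).not_ge (pow_le_pow_right' hh.le (Nat.le_succ n))

/-- Otherwise `h ^ n * x ≤ x` for all `n`; with `1 ≤ h ^ m * x` and `x ≤ h ^ p` this gives `h ^ (p +
1) ≤ h ^ (p + 1 + m) * x ≤ x ≤ h ^ p`. -/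
theorem lt_mul_of_isDominatedBy (hG : IsConradianOrder G) {h x : G} (hh : 1 < h)
    (hx : IsDominatedBy h x) : x < h * x := by
  refine hG.lt_of_not_ge fun hle => ?_
  have h2 : ∀ n : ℕ, h ^ n * x ≤ x := by
    intro n
    induction n with
    | zero => simp
    | succ n ih =>
      rw [pow_succ, mul_assoc]
      exact (mul_le_mul_right hle _).trans ih
  obtain ⟨m, hm⟩ := hG.exists_one_le_pow_mul hh hx
  obtain ⟨p, hp⟩ := hx.1
  have h3 : h ^ (p + 1) ≤ h ^ p := by
    have := le_mul_of_one_le_right' (a := h ^ (p + 1)) hm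
    rw [← mul_assoc, ← pow_add] at this
    exact this.trans ((h2 _).trans hp)
  refine h3.not_gt ?_
  rw [pow_succ]
  exact lt_mul_of_one_lt_right' _ hh

theorem isDominatedBy_mul_left (hG : IsConradianOrder G) {w v : G} (hw : 1 ≤ w) (hv : 1 < v) :
    1 < w * v ∧ IsDominatedBy (w * v) v := by
  have h1 : 1 < w * v := hw.trans_lt (lt_mul_of_one_lt_right' w hv)
  refine ⟨h1, ?_⟩
  have h2 : w ∈ hG.dominatedSubgroup h1 :=
    isDominatedBy_of_le hw (lt_mul_of_one_lt_right' w hv).le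
  have h3 : w * v ∈ hG.dominatedSubgroup h1 := isDominatedBy_of_le h1.le le_rfl
  have h4 := mul_mem (inv_mem h2) h3
  rwa [inv_mul_cancel_left] at h4

/-- Source of right invariance in Hölder's theorem: the positive elements dominating `g` are stable
under conjugation by the subgroup that `g` dominates. -/
theorem conj_of_isDominatedBy (hG : IsConradianOrder G) {g v y : G} (hg : 1 < g) (hv : 1 < v)
    (hvg : IsDominatedBy v g) (hy : IsDominatedBy g y) :
    1 < y⁻¹ * v * y ∧ IsDominatedBy (y⁻¹ * v * y) g := by
  have hvy := hG.isDominatedBy_trans hv hvg hy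
  have hpow : ∀ k : ℕ, (y⁻¹ * v * y) ^ k = y⁻¹ * v ^ k * y := fun k => by
    simpa using conj_pow (a := y⁻¹) (b := v) (i := k)
  refine ⟨?_, ?_, 0, by simpa using hg.le⟩
  · rw [mul_assoc, lt_inv_mul_iff_mul_lt, mul_one]
    exact hG.lt_mul_of_isDominatedBy hv hvy
  · have hz : y * g * y⁻¹ ∈ hG.dominatedSubgroup hv := mul_mem (mul_mem hvy hvg) (inv_mem hvy)
    obtain ⟨m, hm⟩ := hz.1
    have hw : 1 ≤ (y * g * y⁻¹)⁻¹ * v ^ m := by rwa [le_inv_mul_iff_mul_le, mul_one]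
    -- The product of `(y * g * y⁻¹)⁻¹ * v ^ m` and `v` dominates `v`, hence `y`, and so moves `y`
    -- up; cancelling `y` gives `g < (y⁻¹ * v * y) ^ (m + 1)`.
    obtain ⟨h1, h2⟩ := hG.isDominatedBy_mul_left hw hv
    have h3 := hG.lt_mul_of_isDominatedBy h1 (hG.isDominatedBy_trans h1 h2 hvy)
    refine ⟨m + 1, ?_⟩
    have h4 : (y * g * y⁻¹)⁻¹ * v ^ m * v * y = y * (g⁻¹ * (y⁻¹ * v * y) ^ (m + 1)) := by
      rw [hpow, pow_succ]
      group
    rw [h4] at h3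
    have h5 : 1 < g⁻¹ * (y⁻¹ * v * y) ^ (m + 1) := by
      simpa using mul_lt_mul_right h3 y⁻¹
    rw [lt_inv_mul_iff_mul_lt, mul_one] at h5
    exact h5.le

/-- This is transitivity, in contrapositive form, of the coarsened relation used in
`exists_additive`. -/
theorem isDominatedBy_or_of_mul (hG : IsConradianOrder G) {g x y : G}
    (hxy : 1 < x * y) (hxyg : IsDominatedBy (x * y) g) :
    (1 < x ∧ IsDominatedBy x g) ∨ (1 < y ∧ IsDominatedBy y g) := by
  by_cases hx : x ≤ 1
  · right
    obtain ⟨h1, h2⟩ := hG.isDominatedBy_mul_left (Left.one_le_inv_iff.2 hx) hxy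
    rw [inv_mul_cancel_left] at h1 h2
    exact ⟨h1, hG.isDominatedBy_trans h1 h2 hxyg⟩
  by_cases hy : y ≤ 1
  · left
    have h1 : x * y ≤ x := mul_le_of_le_one_right' hy
    have h2 := hxy.trans_le h1
    exact ⟨h2, hG.isDominatedBy_trans h2 (isDominatedBy_of_le hxy.le h1) hxyg⟩
  replace hx := hG.lt_of_not_ge hx
  replace hy := hG.lt_of_not_ge hy
  rcases hG.total x y with h | h
  · refine .inr ⟨hy, hG.isDominatedBy_trans hy ?_ hxyg⟩
    exact (hG.dominatedSubgroup hy).mul_mem (isDominatedBy_of_le hx.le h)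
      (isDominatedBy_of_le hy.le le_rfl)
  · refine .inl ⟨hx, hG.isDominatedBy_trans hx ?_ hxyg⟩
    exact (hG.dominatedSubgroup hx).mul_mem (isDominatedBy_of_le hx.le le_rfl)
      (isDominatedBy_of_le hy.le h)

/-- Conrad's theorem: every positive element of a Conradian order lies in a convex subgroup
with an order-preserving homomorphism to `ℝ` that is positive on it. -/
theorem exists_additive (hG : IsConradianOrder G) {g : G} (hg : 1 < g) :
    ∃ τ : G → ℝ,
      (∀ x ∈ hG.dominatedSubgroup hg, ∀ y ∈ hG.dominatedSubgroup hg, τ (x * y) = τ x + τ y) ∧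
      (∀ x ∈ hG.dominatedSubgroup hg, 1 ≤ x → 0 ≤ τ x) ∧ 0 < τ g := by
  classical
  let D := hG.dominatedSubgroup hg
  have le_of_le : ∀ a b : G, a ≤ b → ¬ (1 < b⁻¹ * a ∧ IsDominatedBy (b⁻¹ * a) g) :=
    fun a b h h1 => h1.1.not_ge (by rwa [inv_mul_le_iff_le_mul, mul_one])
  have hgD : g ∈ D := isDominatedBy_of_le hg.le le_rfl
  -- Hölder's theorem is applied to a coarser relation: `a` exceeds `b` only if `b⁻¹ * a` is
  -- positive and large enough to dominate `g`. Smaller differences are ignored, which makes the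
  -- relation bi-invariant.
  obtain ⟨τ, hmul, hnonneg, hpos⟩ := exists_additive_of_cofinal (E := D) (g := ⟨g, hgD⟩)
    (fun a b => ¬ (1 < (b : G)⁻¹ * a ∧ IsDominatedBy ((b : G)⁻¹ * a) g))
    (fun a b => (hG.total (a : G) b).imp (le_of_le _ _) (le_of_le _ _))
    (fun a b c hab hbc h => by
      have habc : (c : G)⁻¹ * a = ((c : G)⁻¹ * b) * ((b : G)⁻¹ * a) := by group
      rw [habc] at h
      exact (hG.isDominatedBy_or_of_mul h.1 h.2).elim hbc hab)
    (fun c a b h => by simpa [mul_assoc] using h)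
    (fun c a b h h' => h (by
      simpa [mul_assoc] using hG.conj_of_isDominatedBy hg h'.1 h'.2 (inv_mem c.2)))
    (by simpa using ⟨hg, hgD⟩)
    (fun x => by
      obtain ⟨n, hn⟩ := x.2.1
      exact ⟨n, le_of_le _ _ (by simpa using hn)⟩)
  refine ⟨fun x => if h : x ∈ hG.dominatedSubgroup hg then τ ⟨x, h⟩ else 0, ?_, ?_, ?_⟩
  · intro x hx y hy
    simp only [hx, hy, mul_mem hx hy, dif_pos]
    exact hmul ⟨x, hx⟩ ⟨y, hy⟩
  · intro x hx h
    simp only [hx, dif_pos]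
    exact hnonneg ⟨x, hx⟩ (le_of_le _ _ (by simpa using h))
  · simpa [show g ∈ hG.dominatedSubgroup hg from hgD] using hpos

end IsConradianOrder

end Conrad

/-! ### Positive cones, convex subgroups, levels and modifications. -/

namespace LeftPreorder

variable {G : Type*} [Group G]

/-- A left-preorder as an instance of `Preorder`. -/
abbrev toPreorder (r : LeftPreorder G) : Preorder G where
  le := r.le
  le_refl := r.refl
  le_trans := r.trans

theorem toPreorder_mulLeftMono (r : LeftPreorder G) : @MulLeftMono G _ r.toPreorder.toLE :=
  @CovariantClass.mk _ _ _ _ fun c a b h => r.left_invariant c a b h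

theorem lt_of_not_le (r : LeftPreorder G) {a b : G} (h : ¬ r.le a b) : r.lt b a :=
  ⟨(r.total a b).resolve_left h, h⟩

theorem one_le_inv_mul (r : LeftPreorder G) {a b : G} : r.le 1 (a⁻¹ * b) ↔ r.le a b :=
  ⟨fun h => by simpa using r.left_invariant a _ _ h,
    fun h => by simpa using r.left_invariant a⁻¹ _ _ h⟩

theorem inv_mul_le_one (r : LeftPreorder G) {a b : G} : r.le (a⁻¹ * b) 1 ↔ r.le b a :=
  ⟨fun h => by simpa using r.left_invariant a _ _ h,
    fun h => by simpa using r.left_invariant a⁻¹ _ _ h⟩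

theorem one_lt_inv_mul (r : LeftPreorder G) {a b : G} : r.lt 1 (a⁻¹ * b) ↔ r.lt a b := by
  rw [lt, lt, one_le_inv_mul, inv_mul_le_one]

theorem one_le_inv (r : LeftPreorder G) {a : G} : r.le 1 a⁻¹ ↔ r.le a 1 := by
  simpa using r.one_le_inv_mul (a := a) (b := 1)

theorem inv_le_one (r : LeftPreorder G) {a : G} : r.le a⁻¹ 1 ↔ r.le 1 a := by
  simpa using r.inv_mul_le_one (a := a) (b := 1)

theorem one_lt_inv (r : LeftPreorder G) {a : G} : r.lt 1 a⁻¹ ↔ r.lt a 1 := by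
  simpa using r.one_lt_inv_mul (a := a) (b := 1)

theorem one_le_mul (r : LeftPreorder G) {a b : G} (ha : r.le 1 a) (hb : r.le 1 b) :
    r.le 1 (a * b) :=
  r.trans _ _ _ ha (by simpa using r.left_invariant a _ _ hb)

theorem one_lt_mul (r : LeftPreorder G) {a b : G} (ha : r.lt 1 a) (hb : r.lt 1 b) :
    r.lt 1 (a * b) := by
  refine ⟨r.one_le_mul ha.1 hb.1, fun h => hb.2 ?_⟩
  have h1 : r.le (a * b) a := r.trans _ _ _ h ha.1
  simpa using r.left_invariant a⁻¹ _ _ h1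

theorem one_le_pow (r : LeftPreorder G) {a : G} (ha : r.le 1 a) (n : ℕ) : r.le 1 (a ^ n) := by
  induction n with
  | zero => simpa using r.refl 1
  | succ n ih => rw [pow_succ]; exact r.one_le_mul ih ha

theorem pow_le_one (r : LeftPreorder G) {a : G} (ha : r.le a 1) (n : ℕ) : r.le (a ^ n) 1 := by
  rw [← one_le_inv, ← inv_pow]
  exact r.one_le_pow (r.one_le_inv.2 ha) n

theorem le_pow (r : LeftPreorder G) {a : G} (ha : r.le 1 a) {n : ℕ} (hn : n ≠ 0) :
    r.le a (a ^ n) := by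
  obtain ⟨k, rfl⟩ := Nat.exists_eq_succ_of_ne_zero hn
  rw [pow_succ']
  simpa using r.left_invariant a _ _ (r.one_le_pow ha k)

theorem not_one_lt_of_one_lt_inv (r : LeftPreorder G) {a : G} (h : r.lt 1 a⁻¹) : ¬ r.lt 1 a :=
  fun h' => h'.2 (r.one_le_inv.1 h.1)

theorem mem_iff (r : LeftPreorder G) {C : Subgroup G} (h : r.IsRelativeTo C) {g : G} :
    g ∈ C ↔ r.le 1 g ∧ r.le g 1 := by
  rw [IsRelativeTo] at h
  rw [← SetLike.mem_coe, ← h]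
  rfl

theorem trichotomy (r : LeftPreorder G) {C : Subgroup G} (h : r.IsRelativeTo C) (g : G) :
    r.lt 1 g ∨ g ∈ C ∨ r.lt 1 g⁻¹ := by
  rw [r.mem_iff h, one_lt_inv, lt, lt]
  have := r.total 1 g
  tauto

theorem not_mem_of_one_lt (r : LeftPreorder G) {C : Subgroup G} (h : r.IsRelativeTo C) {g : G}
    (hg : r.lt 1 g) : g ∉ C := fun hC => hg.2 ((r.mem_iff h).1 hC).2

theorem ext_of_one_lt {r s : LeftPreorder G} (h : ∀ g, r.lt 1 g ↔ s.lt 1 g) : r = s := by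
  ext a b
  rw [le_iff_not_lt, le_iff_not_lt, h]

/-- A subsemigroup `P` such that `G` is the disjoint union of `P`, `C`, `P⁻¹` is the positive cone
of a left-preorder relative to `C`. -/
theorem exists_one_lt_iff_of_cone {C : Subgroup G} (hC : C ≠ ⊤) (P : Set G)
    (mul_mem : ∀ a ∈ P, ∀ b ∈ P, a * b ∈ P) (not_mem : ∀ a ∈ P, a ∉ C)
    (cover : ∀ a, a ∈ P ∨ a ∈ C ∨ a⁻¹ ∈ P) :
    ∃ r : LeftPreorder G, (∀ g, r.lt 1 g ↔ g ∈ P) ∧ r.IsRelativeTo C := by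
  have inv_notMem : ∀ a ∈ P, a⁻¹ ∉ P := fun a ha ha' =>
    not_mem _ (mul_mem _ ha _ ha') (by simp)
  have split : ∀ x y, x * y ∈ P → x ∈ P ∨ y ∈ P := by
    intro x y hxy
    rcases cover x with hx | hx | hx
    · exact .inl hx
    · rcases cover y with hy | hy | hy
      · exact .inr hy
      · exact absurd (C.mul_mem hx hy) (not_mem _ hxy)
      · left
        simpa using mul_mem _ hxy _ hy
    · right
      simpa using mul_mem _ hx _ hxy
  have hCP : ∀ g ∈ C, g ∉ P := fun g hg hP => not_mem g hP hg
  refine ⟨⟨fun a b => b⁻¹ * a ∉ P, fun a h => ?_, fun a b c hab hbc h => ?_, fun a b => ?_,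
    fun g a b h => by simpa [mul_assoc] using h, fun h => hC ?_⟩, fun g => ?_, ?_⟩
  · exact not_mem _ h (by simp)
  · have h1 : c⁻¹ * a = (c⁻¹ * b) * (b⁻¹ * a) := by group
    rw [h1] at h
    exact (split _ _ h).elim hbc hab
  · by_contra! h
    exact inv_notMem _ h.1 (by simpa using h.2)
  · rw [eq_top_iff]
    intro g _
    rcases cover g with hg | hg | hg
    · exact absurd (by simpa using hg) (h g 1)
    · exact hg
    · exact absurd (by simpa using hg) (h g⁻¹ 1)
  · simp only [lt, mul_one, inv_one, one_mul, not_not]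
    exact ⟨fun h => h.2, fun h => ⟨inv_notMem g h, h⟩⟩
  · ext g
    simp only [mul_one, inv_one, one_mul, Set.mem_ofPred_eq, SetLike.mem_coe]
    constructor
    · rintro ⟨h1, h2⟩
      rcases cover g with hg | hg | hg
      · exact absurd hg h2
      · exact hg
      · exact absurd hg h1
    · exact fun hg => ⟨hCP _ (C.inv_mem hg), hCP _ hg⟩

/-- A subgroup is convex if it contains every element between `1` and one of its elements. -/
def IsConvex (r : LeftPreorder G) (E : Subgroup G) : Prop :=
  ∀ x y, r.le 1 x → r.le x y → y ∈ E → x ∈ E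

/-- The function `τ` restricts to a homomorphism from `E` to `ℝ`. -/
def _root_.AdditiveOn (E : Subgroup G) (τ : G → ℝ) : Prop :=
  ∀ x ∈ E, ∀ y ∈ E, τ (x * y) = τ x + τ y

theorem _root_.AdditiveOn.map_one {E : Subgroup G} {τ : G → ℝ} (h : AdditiveOn E τ) :
    τ 1 = 0 := by
  simpa using h 1 E.one_mem 1 E.one_mem

theorem _root_.AdditiveOn.map_inv {E : Subgroup G} {τ : G → ℝ} (h : AdditiveOn E τ) {x : G}
    (hx : x ∈ E) : τ x⁻¹ = -τ x := by
  have := h x hx x⁻¹ (E.inv_mem hx)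
  rw [mul_inv_cancel, h.map_one] at this
  linarith

theorem _root_.AdditiveOn.map_pow {E : Subgroup G} {τ : G → ℝ} (h : AdditiveOn E τ) {x : G}
    (hx : x ∈ E) (n : ℕ) : τ (x ^ n) = n * τ x := by
  induction n with
  | zero => simp [h.map_one]
  | succ n ih =>
    rw [pow_succ, h _ (E.pow_mem hx n) _ hx, ih]
    push_cast
    ring

/-- The kernel of a function that is additive on `E`. -/
def _root_.AdditiveOn.ker {E : Subgroup G} {τ : G → ℝ} (h : AdditiveOn E τ) : Subgroup G where
  carrier := {x | x ∈ E ∧ τ x = 0}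
  one_mem' := ⟨E.one_mem, h.map_one⟩
  mul_mem' := fun {a b} ha hb => ⟨E.mul_mem ha.1 hb.1, by rw [h _ ha.1 _ hb.1, ha.2, hb.2, add_zero]⟩
  inv_mem' := fun {a} ha => ⟨E.inv_mem ha.1, by rw [h.map_inv ha.1, ha.2, neg_zero]⟩

/-- A convex subgroup `E` with a homomorphism to `ℝ` that preserves the order. -/
structure IsLevel (r : LeftPreorder G) (E : Subgroup G) (τ : G → ℝ) : Prop where
  convex : r.IsConvex E
  additive : AdditiveOn E τ
  nonneg : ∀ x ∈ E, r.le 1 x → 0 ≤ τ x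

theorem IsConvex.le {r : LeftPreorder G} {C E : Subgroup G} (hr : r.IsRelativeTo C)
    (h : r.IsConvex E) : C ≤ E := fun c hc =>
  h c 1 ((r.mem_iff hr).1 hc).1 ((r.mem_iff hr).1 hc).2 E.one_mem

/-- Only strict inequalities need checking, since ties differ by an element of `C`. -/
theorem isConvex_of_one_lt {r : LeftPreorder G} {C E : Subgroup G} (hr : r.IsRelativeTo C)
    (hCE : C ≤ E) (h : ∀ x y, y ∈ E → r.lt 1 x → r.lt 1 (x⁻¹ * y) → x ∈ E) : r.IsConvex E := by
  intro x y hx hxy hy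
  by_contra hxE
  have hxy' := r.one_le_inv_mul.2 hxy
  have h1 : r.lt 1 x := ⟨hx, fun h => hxE (hCE ((r.mem_iff hr).2 ⟨hx, h⟩))⟩
  refine hxE (h x y hy h1 ⟨hxy', fun h' => hxE ?_⟩)
  have := E.mul_mem hy (E.inv_mem (hCE ((r.mem_iff hr).2 ⟨hxy', h'⟩)))
  simpa using this

theorem IsConvex.of_pow_mem {r : LeftPreorder G} {E : Subgroup G} (h : r.IsConvex E) {x : G}
    {n : ℕ} (hn : n ≠ 0) (hx : x ^ n ∈ E) : x ∈ E := by
  rcases r.total 1 x with h1 | h1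
  · exact h _ _ h1 (r.le_pow h1 hn) hx
  · rw [← one_le_inv] at h1
    rw [← inv_mem_iff]
    refine h _ _ h1 (r.le_pow h1 hn) ?_
    rw [inv_pow]
    exact E.inv_mem hx

namespace IsLevel

variable {r : LeftPreorder G} {E : Subgroup G} {τ : G → ℝ}

theorem mono (h : r.IsLevel E τ) {x y : G} (hx : x ∈ E) (hy : y ∈ E) (hxy : r.le x y) :
    τ x ≤ τ y := by
  have := h.nonneg _ (E.mul_mem (E.inv_mem hx) hy) (r.one_le_inv_mul.2 hxy)
  rw [h.additive _ (E.inv_mem hx) _ hy, h.additive.map_inv hx] at this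
  linarith

theorem one_lt_of_pos (h : r.IsLevel E τ) {x : G} (hx : x ∈ E) (hpos : 0 < τ x) : r.lt 1 x := by
  refine r.lt_of_not_le fun hle => hpos.not_ge ?_
  simpa [h.additive.map_one] using h.mono hx E.one_mem hle

theorem eq_zero_of_mem {C : Subgroup G} (h : r.IsLevel E τ) (hr : r.IsRelativeTo C) {c : G}
    (hc : c ∈ C) : τ c = 0 := by
  have hcE := h.convex.le hr hc
  have hc' := (r.mem_iff hr).1 hc
  refine le_antisymm ?_ (h.nonneg _ hcE hc'.1)
  simpa [h.additive.map_one] using h.mono hcE E.one_mem hc'.2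

/-- A subgroup bounded above by `g` has bounded image in `ℝ`, and a bounded subgroup of `ℝ` is
trivial. -/
theorem le_ker_of_forall_le (h : r.IsLevel E τ) {D : Subgroup G} {g : G} (hg : g ∈ E)
    (hD : ∀ e ∈ D, r.le e g) : D ≤ h.additive.ker := by
  have h1 : D ≤ E := by
    intro e he
    rcases r.total 1 e with h1 | h1
    · exact h.convex _ _ h1 (hD e he) hg
    · rw [← inv_mem_iff]
      exact h.convex _ _ (r.one_le_inv.2 h1) (hD _ (D.inv_mem he)) hg
  have h2 : ∀ e ∈ D, τ e ≤ 0 := by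
    intro e he
    by_contra! hpos
    obtain ⟨n, hn⟩ := exists_nat_gt (τ g / τ e)
    rw [div_lt_iff₀ hpos, ← h.additive.map_pow (h1 he)] at hn
    exact hn.not_ge (h.mono (h1 (D.pow_mem he n)) hg (hD _ (D.pow_mem he n)))
  refine fun e he => ⟨h1 he, le_antisymm (h2 e he) ?_⟩
  have := h2 _ (D.inv_mem he)
  rw [h.additive.map_inv (h1 he)] at this
  linarith

end IsLevel

theorem isConradian_iff_sq (r : LeftPreorder G) :
    r.IsConradian ↔ ∀ a b, r.lt 1 a → r.lt 1 b → r.lt a (b * a ^ 2) := by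
  refine ⟨fun h a b ha hb => ?_, fun h a b ha hb => ⟨2, h a b ha hb⟩⟩
  let _ := r.toPreorder
  have := r.toPreorder_mulLeftMono
  have := mulLeftStrictMono_of_mulLeftMono (G := G)
  exact IsConradianOrder.lt_mul_sq ⟨r.total, h⟩ hb ha

theorem exists_isLevel {r : LeftPreorder G} (hr : r.IsConradian) {g : G} (hg : r.lt 1 g) :
    ∃ E τ, r.IsLevel E τ ∧ g ∈ E ∧ 0 < τ g ∧ ∀ x ∈ E, ∃ n : ℕ, r.le x (g ^ n) := by
  let _ := r.toPreorder
  have := r.toPreorder_mulLeftMono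
  have := mulLeftStrictMono_of_mulLeftMono (G := G)
  have hG : IsConradianOrder G := ⟨r.total, hr⟩
  obtain ⟨τ, hadd, hnonneg, hpos⟩ := hG.exists_additive hg
  refine ⟨hG.dominatedSubgroup hg, τ, ⟨?_, hadd, hnonneg⟩, isDominatedBy_of_le hg.1 (r.refl g),
    hpos, fun x hx => hx.1⟩
  rintro x y hx hxy ⟨⟨n, hn⟩, -⟩
  exact ⟨⟨n, r.trans _ _ _ hxy hn⟩, 0, by simpa using (show (1 : G) ≤ x from hx)⟩

/-- The level of the larger of `a`, `b` contains both, and there `τ (a⁻¹ * (b * a ^ 2)) = τ a + τ b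
> 0`. -/
theorem isConradian_of_exists_isLevel {r : LeftPreorder G}
    (h : ∀ g, r.lt 1 g → ∃ E τ, r.IsLevel E τ ∧ g ∈ E ∧ 0 < τ g) : r.IsConradian := by
  rw [isConradian_iff_sq]
  intro a b ha hb
  have key : ∃ E τ, r.IsLevel E τ ∧ a ∈ E ∧ b ∈ E ∧ 0 < τ a + τ b := by
    rcases r.total a b with hab | hab
    · obtain ⟨E, τ, hE, hb', hpos⟩ := h b hb
      have ha' := hE.convex _ _ ha.1 hab hb'
      exact ⟨E, τ, hE, ha', hb', by linarith [hE.nonneg _ ha' ha.1]⟩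
    · obtain ⟨E, τ, hE, ha', hpos⟩ := h a ha
      have hb' := hE.convex _ _ hb.1 hab ha'
      exact ⟨E, τ, hE, ha', hb', by linarith [hE.nonneg _ hb' hb.1]⟩
  obtain ⟨E, τ, hE, ha', hb', hpos⟩ := key
  rw [← one_lt_inv_mul]
  have hba : b * a ^ 2 ∈ E := E.mul_mem hb' (E.pow_mem ha' 2)
  refine hE.one_lt_of_pos (E.mul_mem (E.inv_mem ha') hba) ?_
  rw [hE.additive _ (E.inv_mem ha') _ hba, hE.additive _ hb' _ (E.pow_mem ha' 2),
    hE.additive.map_inv ha', hE.additive.map_pow ha']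
  push_cast
  linarith

/-- A Conradian preorder stays Conradian if on a convex subgroup `E` the sign is replaced by the
sign of a homomorphism `σ`, wherever `σ` does not vanish. -/
theorem exists_modification {C : Subgroup G} (hC : C ≠ ⊤) {r : LeftPreorder G} (hr : r ∈ Cord C)
    {E : Subgroup G} (hE : r.IsConvex E) {σ : G → ℝ} (hσ : AdditiveOn E σ)
    (hσC : ∀ c ∈ C, σ c = 0) :
    ∃ s ∈ Cord C, ∀ g, s.lt 1 g ↔
      (g ∉ E ∧ r.lt 1 g) ∨ (g ∈ E ∧ (0 < σ g ∨ (σ g = 0 ∧ r.lt 1 g))) := by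
  obtain ⟨hrC, hrc⟩ := hr
  have hCE := hE.le hrC
  have hlt : ∀ g e, r.lt 1 g → g ∉ E → e ∈ E → r.lt e g := fun g e hg hgE he =>
    r.lt_of_not_le fun hle => hgE (hE _ _ hg.1 hle he)
  -- Positive elements outside `E` absorb `E` on both sides, so the new cone is a semigroup.
  have hEmul : ∀ g e, r.lt 1 g → g ∉ E → e ∈ E → r.lt 1 (e * g) := fun g e hg hgE he => by
    simpa using r.one_lt_inv_mul.2 (hlt g e⁻¹ hg hgE (E.inv_mem he))
  have hmulE : ∀ g e, r.lt 1 g → g ∉ E → e ∈ E → r.lt 1 (g * e) := by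
    refine fun g e hg hgE he => r.lt_of_not_le fun hle => hgE ?_
    have h1 : r.le 1 (e⁻¹ * g⁻¹) := by
      rw [← mul_inv_rev]
      exact r.one_le_inv.2 hle
    have h2 : r.le (e⁻¹ * g⁻¹) e⁻¹ := by
      simpa using r.left_invariant e⁻¹ _ _ (r.inv_le_one.2 hg.1)
    have h3 := hE _ _ h1 h2 (E.inv_mem he)
    rwa [E.mul_mem_cancel_left (E.inv_mem he), inv_mem_iff] at h3
  obtain ⟨s, hs, hsC⟩ := exists_one_lt_iff_of_cone hC
    {g | (g ∉ E ∧ r.lt 1 g) ∨ (g ∈ E ∧ (0 < σ g ∨ (σ g = 0 ∧ r.lt 1 g)))}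
    (by
      rintro a (⟨haE, ha⟩ | ⟨haE, ha⟩) b (⟨hbE, hb⟩ | ⟨hbE, hb⟩)
      · refine .inl ⟨fun h => haE (hE a (a * b) ha.1 ?_ h), r.one_lt_mul ha hb⟩
        simpa using r.left_invariant a _ _ hb.1
      · exact .inl ⟨fun h => haE ((E.mul_mem_cancel_right hbE).1 h), hmulE a b ha haE hbE⟩
      · exact .inl ⟨fun h => hbE ((E.mul_mem_cancel_left haE).1 h), hEmul b a hb hbE haE⟩
      · refine .inr ⟨E.mul_mem haE hbE, ?_⟩
        rw [hσ a haE b hbE]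
        rcases ha with ha | ⟨ha, ha'⟩ <;> rcases hb with hb | ⟨hb, hb'⟩
        · exact .inl (by linarith)
        · exact .inl (by linarith)
        · exact .inl (by linarith)
        · exact .inr ⟨by linarith, r.one_lt_mul ha' hb'⟩)
    (by
      rintro a (⟨haE, -⟩ | ⟨haE, h | ⟨-, h⟩⟩) haC
      · exact haE (hCE haC)
      · exact h.ne' (hσC a haC)
      · exact r.not_mem_of_one_lt hrC h haC)
    (by
      intro a
      simp only [Set.mem_ofPred_eq, inv_mem_iff]
      have h := r.trichotomy hrC a
      by_cases haE : a ∈ E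
      · rw [hσ.map_inv haE]
        rcases lt_trichotomy (σ a) 0 with h1 | h1 | h1
        · exact .inr (.inr (.inr ⟨haE, .inl (by linarith)⟩))
        · simp only [haE, h1]
          simp
          tauto
        · exact .inl (.inr ⟨haE, .inl h1⟩)
      · have : a ∉ C := fun h => haE (hCE h)
        tauto)
  replace hs : ∀ g, s.lt 1 g ↔
      (g ∉ E ∧ r.lt 1 g) ∨ (g ∈ E ∧ (0 < σ g ∨ (σ g = 0 ∧ r.lt 1 g))) := hs
  have hsE : ∀ g ∉ E, (s.lt 1 g ↔ r.lt 1 g) := fun g hg => by simp [hs g, hg]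
  have hsE' : ∀ g ∈ E, (s.lt 1 g ↔ 0 < σ g ∨ (σ g = 0 ∧ r.lt 1 g)) := fun g hg => by
    simp [hs g, hg]
  have convex_of_le : ∀ F : Subgroup G, E ≤ F → r.IsConvex F → s.IsConvex F := by
    intro F hEF hF
    refine isConvex_of_one_lt hsC (hCE.trans hEF) fun x y hy hx hxy => ?_
    by_contra hxF
    have h1 : x⁻¹ * y ∉ F := fun h => hxF (by simpa using (F.mul_mem_cancel_right hy).1 h)
    rw [hsE _ fun h => h1 (hEF h), one_lt_inv_mul] at hxy
    rw [hsE _ fun h => hxF (hEF h)] at hx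
    exact hxF (hF x y hx.1 hxy.1 hy)
  refine ⟨s, ⟨hsC, isConradian_of_exists_isLevel fun g hg => ?_⟩, hs⟩
  -- Levels for `s`: `(E, σ)` if `σ g > 0`; an old level cut down to the kernel of `σ` if `σ g = 0`;
  -- an old level, whose kernel contains `E`, if `g ∉ E`.
  by_cases hgE : g ∈ E
  · rw [hsE' g hgE] at hg
    rcases hg with hg | ⟨hσg, hg⟩
    · refine ⟨E, σ, ⟨convex_of_le E le_rfl hE, hσ, fun x hx hx1 => ?_⟩, hgE, hg⟩
      by_contra! hneg
      have h1 : s.lt 1 x⁻¹ := by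
        rw [hsE' _ (E.inv_mem hx), hσ.map_inv hx]
        exact .inl (by linarith)
      exact (s.one_lt_inv.1 h1).2 hx1
    · obtain ⟨F, τ, hF, hgF, hpos, -⟩ := exists_isLevel hrc hg
      refine ⟨F ⊓ hσ.ker, τ, ⟨isConvex_of_one_lt hsC
        (le_inf (hF.convex.le hrC) fun c hc => ⟨hCE hc, hσC c hc⟩) fun x y hy hx hxy => ?_,
        fun x hx y hy => hF.additive x hx.1 y hy.1, fun x hx hx1 => hF.nonneg x hx.1 ?_⟩,
        ⟨hgF, hgE, hσg⟩, hpos⟩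
      · obtain ⟨hyF, hyE, hσy⟩ := hy
        have hxE := convex_of_le E le_rfl hE x y hx.1 (s.one_lt_inv_mul.1 hxy).1 hyE
        rw [hsE' x hxE] at hx
        rw [hsE' _ (E.mul_mem (E.inv_mem hxE) hyE), hσ _ (E.inv_mem hxE) _ hyE,
          hσ.map_inv hxE, hσy] at hxy
        have h0 : σ x = 0 := by
          rcases hx with h | ⟨h, -⟩ <;> rcases hxy with h' | ⟨h', -⟩ <;> linarith
        rw [h0] at hx hxy
        simp only [lt_irrefl, false_or, true_and, neg_zero, add_zero] at hx hxy
        exact ⟨hF.convex x y hx.1 (r.one_lt_inv_mul.1 hxy).1 hyF, hxE, h0⟩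
      · obtain ⟨-, hxE, hσx⟩ := hx
        by_contra h
        have h1 : r.lt 1 x⁻¹ := r.one_lt_inv.2 (r.lt_of_not_le h)
        have h2 : s.lt 1 x⁻¹ := by
          rw [hsE' _ (E.inv_mem hxE), hσ.map_inv hxE, hσx]
          exact .inr ⟨neg_zero, h1⟩
        exact (s.one_lt_inv.1 h2).2 hx1
  · rw [hsE g hgE] at hg
    obtain ⟨F, τ, hF, hgF, hpos, -⟩ := exists_isLevel hrc hg
    have hEF := hF.le_ker_of_forall_le hgF fun e he => (hlt g e hg hgE he).1
    refine ⟨F, τ, ⟨convex_of_le F (fun e he => (hEF he).1) hF.convex, hF.additive,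
      fun x hx hx1 => ?_⟩, hgF, hpos⟩
    by_cases hxE : x ∈ E
    · exact (hEF hxE).2.ge
    · refine hF.nonneg x hx ?_
      by_contra h
      have h1 : r.lt 1 x⁻¹ := r.one_lt_inv.2 (r.lt_of_not_le h)
      rw [← hsE _ (by simpa using hxE)] at h1
      exact (s.one_lt_inv.1 h1).2 hx1

end LeftPreorder

/-! ### An isolated preorder forces finiteness. -/

namespace LeftPreorder

variable {G : Type*} [Group G]

/-- The preorder `r` is the only element of `Cord C` for which all elements of `T` are positive. -/
structure IsIsolatedBy (r : LeftPreorder G) (C : Subgroup G) (T : Finset G) : Prop where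
  ne_top : C ≠ ⊤
  mem : r ∈ Cord C
  pos : ∀ t ∈ T, r.lt 1 t
  eq : ∀ s ∈ Cord C, (∀ t ∈ T, s.lt 1 t) → s = r

/-- A level whose group is the smallest convex subgroup containing `g`. -/
structure IsPrincipalLevel (r : LeftPreorder G) (g : G) (E : Subgroup G) (τ : G → ℝ) : Prop
    extends r.IsLevel E τ where
  mem : g ∈ E
  pos : 0 < τ g
  cofinal : ∀ x ∈ E, ∃ n : ℕ, r.le x (g ^ n)

theorem exists_isPrincipalLevel {r : LeftPreorder G} (hr : r.IsConradian) {g : G}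
    (hg : r.lt 1 g) : ∃ E τ, r.IsPrincipalLevel g E τ := by
  obtain ⟨E, τ, hE, hgE, hpos, hcof⟩ := exists_isLevel hr hg
  exact ⟨E, τ, hE, hgE, hpos, hcof⟩

theorem IsPrincipalLevel.le_of_mem {r : LeftPreorder G} {g : G} {E : Subgroup G} {τ : G → ℝ}
    (h : r.IsPrincipalLevel g E τ) {D : Subgroup G} (hD : r.IsConvex D) (hg : g ∈ D) : E ≤ D := by
  intro x hx
  rcases r.total 1 x with h1 | h1
  · obtain ⟨n, hn⟩ := h.cofinal x hx
    exact hD _ _ h1 hn (D.pow_mem hg n)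
  · obtain ⟨n, hn⟩ := h.cofinal x⁻¹ (E.inv_mem hx)
    rw [← inv_mem_iff]
    exact hD _ _ (r.one_le_inv.2 h1) hn (D.pow_mem hg n)

theorem IsLevel.isConvex_ker {r : LeftPreorder G} {E : Subgroup G} {τ : G → ℝ}
    (h : r.IsLevel E τ) : r.IsConvex h.additive.ker := by
  rintro x y hx hxy ⟨hy, hy0⟩
  have hxE := h.convex x y hx hxy hy
  exact ⟨hxE, le_antisymm (hy0 ▸ h.mono hxE hy hxy) (h.nonneg x hxE hx)⟩

theorem IsLevel.exists_le_pow {r : LeftPreorder G} {E : Subgroup G} {τ : G → ℝ}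
    (h : r.IsLevel E τ) {u x : G} (hu : u ∈ E) (hx : x ∈ E) (hpos : 0 < τ u) :
    ∃ n : ℕ, r.le x (u ^ n) := by
  obtain ⟨n, hn⟩ := exists_nat_gt (τ x / τ u)
  rw [div_lt_iff₀ hpos, ← h.additive.map_pow hu] at hn
  exact ⟨n, (r.total _ _).resolve_right fun hle => hn.not_ge (h.mono (E.pow_mem hu n) hx hle)⟩

theorem exists_rat_linear_of_not_commensurable {α β : ℝ} (hα : 0 < α) (hβ : 0 < β)
    (h : ¬ ∃ a b : ℕ, 0 < a ∧ 0 < b ∧ a * α = b * β) :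
    ∃ φ : ℝ →+ ℝ, φ α = 0 ∧ φ β = 1 := by
  have hnot : β ∉ Submodule.span ℚ {α} := by
    intro hmem
    obtain ⟨q, hq⟩ := Submodule.mem_span_singleton.1 hmem
    rw [Rat.smul_def] at hq
    have hq0 : 0 < q := by
      have : (0 : ℝ) < q := by
        by_contra! hle
        nlinarith
      exact_mod_cast this
    obtain ⟨n, hn⟩ := Int.eq_ofNat_of_zero_le (Rat.num_pos.2 hq0).le
    have hn0 : 0 < n := by
      have := Rat.num_pos.2 hq0
      omega
    refine h ⟨n, q.den, hn0, q.den_pos, ?_⟩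
    have h1 : (q : ℝ) = n / q.den := by
      rw [Rat.cast_def, hn]
      simp
    have h2 : (q.den : ℝ) ≠ 0 := by exact_mod_cast q.den_pos.ne'
    rw [← hq, h1]
    field_simp
  obtain ⟨f, hf, hker⟩ := Submodule.exists_le_ker_of_notMem hnot
  have hfα : f α = 0 := hker (Submodule.mem_span_singleton_self α)
  refine ⟨⟨⟨fun x => ((f x / f β : ℚ) : ℝ), by simp⟩, fun x y => ?_⟩, ?_, ?_⟩
  · simp [add_div]
  · simp [hfα]
  · have : ((f β : ℚ) : ℝ) ≠ 0 := by exact_mod_cast hf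
    simp [this]

namespace IsIsolatedBy

variable {r : LeftPreorder G} {C : Subgroup G} {T : Finset G}

/-- Otherwise `τ` vanishes on `T ∩ E`, and replacing `τ` by `-τ` on `E` keeps `T` positive but makes
`g` negative. -/
theorem exists_mem_pos (h : r.IsIsolatedBy C T) {E : Subgroup G} {τ : G → ℝ}
    (hE : r.IsLevel E τ) {g : G} (hg : g ∈ E) (hpos : 0 < τ g) : ∃ t ∈ T, t ∈ E ∧ 0 < τ t := by
  by_contra! hcon
  obtain ⟨s, hs, hlt⟩ := exists_modification h.ne_top h.mem hE.convex (σ := fun x => -τ x)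
    (fun x hx y hy => by simp only [hE.additive x hx y hy]; ring)
    (fun c hc => by rw [hE.eq_zero_of_mem h.mem.1 hc, neg_zero])
  have hsr : s = r := h.eq s hs fun t ht => by
    rw [hlt]
    by_cases htE : t ∈ E
    · refine .inr ⟨htE, .inr ⟨?_, h.pos t ht⟩⟩
      have := hE.nonneg t htE (h.pos t ht).1
      linarith [hcon t ht htE]
    · exact .inl ⟨htE, h.pos t ht⟩
  have h1 := (hlt g).1 (hsr ▸ hE.one_lt_of_pos hg hpos)
  rcases h1 with h1 | ⟨-, h1 | h1⟩
  · exact h1.1 hg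
  · linarith
  · linarith [h1.1]

/-- Since `T` is finite, a small `ε` keeps `T` positive when `τ + ε θ` replaces `τ`, so the modified
preorder is `r` itself. -/
theorem exists_perturbation (h : r.IsIsolatedBy C T) {E : Subgroup G} {τ θ : G → ℝ}
    (hE : r.IsLevel E τ) (hθ : AdditiveOn E θ) (hθC : ∀ c ∈ C, θ c = 0)
    (hθT : ∀ t ∈ T, t ∈ E → τ t = 0 → 0 ≤ θ t) :
    ∃ ε : ℝ, 0 < ε ∧ ∀ z ∈ E, r.lt 1 z → 0 ≤ τ z + ε * θ z := by
  have hev : ∀ᶠ ε : ℝ in nhdsWithin 0 (Set.Ioi 0), ∀ t ∈ T, 0 < τ t → 0 < τ t + ε * θ t := by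
    rw [Filter.eventually_all_finset]
    intro t _
    by_cases hpos : 0 < τ t
    · have hcont : Filter.Tendsto (fun ε : ℝ => τ t + ε * θ t) (nhds 0) (nhds (τ t + 0 * θ t)) :=
        Continuous.tendsto (by fun_prop) 0
      rw [zero_mul, add_zero] at hcont
      filter_upwards [(hcont.mono_left nhdsWithin_le_nhds).eventually (lt_mem_nhds hpos)] with ε hε _
      exact hε
    · exact Filter.Eventually.of_forall fun _ h => absurd h hpos
  obtain ⟨ε, hε, hε0⟩ := (hev.and self_mem_nhdsWithin).exists
  refine ⟨ε, hε0, ?_⟩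
  obtain ⟨s, hs, hlt⟩ := exists_modification h.ne_top h.mem hE.convex
    (σ := fun x => τ x + ε * θ x)
    (fun x hx y hy => by simp only [hE.additive x hx y hy, hθ x hx y hy]; ring)
    (fun c hc => by rw [hE.eq_zero_of_mem h.mem.1 hc, hθC c hc]; ring)
  have hsr : s = r := h.eq s hs fun t ht => by
    rw [hlt]
    by_cases htE : t ∈ E
    · refine .inr ⟨htE, ?_⟩
      rcases (hE.nonneg t htE (h.pos t ht).1).eq_or_lt with h0 | h0
      · have h1 : 0 ≤ ε * θ t := mul_nonneg (le_of_lt hε0) (hθT t ht htE h0.symm)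
        rcases h1.eq_or_lt with h2 | h2
        · exact .inr ⟨by rw [← h0, ← h2, add_zero], h.pos t ht⟩
        · exact .inl (by linarith)
      · exact .inl (hε t ht h0)
    · exact .inl ⟨htE, h.pos t ht⟩
  intro z hz hz1
  rw [← hsr, hlt] at hz1
  rcases hz1 with h1 | ⟨-, h1 | h1⟩
  · exact absurd hz h1.1
  · exact h1.le
  · exact h1.1.ge

theorem exists_commensurable (h : r.IsIsolatedBy C T) {E : Subgroup G} {τ : G → ℝ}
    (hE : r.IsLevel E τ) {x y : G} (hx : x ∈ E) (hy : y ∈ E) (hx0 : 0 < τ x) (hy0 : 0 < τ y) :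
    ∃ a b : ℕ, 0 < a ∧ 0 < b ∧ a * τ x = b * τ y := by
  by_contra hcon
  obtain ⟨φ, hφx, hφy⟩ := exists_rat_linear_of_not_commensurable hx0 hy0 hcon
  obtain ⟨ε, hε, hpos⟩ := h.exists_perturbation hE (θ := fun z => φ (τ z))
    (fun u hu v hv => by simp only [hE.additive u hu v hv, map_add])
    (fun c hc => by rw [hE.eq_zero_of_mem h.mem.1 hc, map_zero])
    (fun t _ _ h0 => by rw [h0, map_zero])
  -- With `q = n / m` between `τ y / τ x` and `(τ y + ε) / τ x`, the element `x ^ n * (y ^ m)⁻¹` is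
  -- positive for `τ` and negative for `τ + ε φ ∘ τ`.
  obtain ⟨q, hq1, hq2⟩ := exists_rat_btwn
    (div_lt_div_of_pos_right (lt_add_of_pos_right (τ y) hε) hx0)
  rw [div_lt_iff₀ hx0] at hq1
  rw [lt_div_iff₀ hx0] at hq2
  have hq0 : 0 < q := by
    have : (0 : ℝ) < q := by
      by_contra! hle
      nlinarith
    exact_mod_cast this
  obtain ⟨n, hn⟩ := Int.eq_ofNat_of_zero_le (Rat.num_pos.2 hq0).le
  have hqn : (q : ℝ) = n / q.den := by
    rw [Rat.cast_def, hn]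
    simp
  have hden : (0 : ℝ) < q.den := by exact_mod_cast q.den_pos
  rw [hqn, div_mul_eq_mul_div] at hq1 hq2
  rw [lt_div_iff₀ hden] at hq1
  rw [div_lt_iff₀ hden] at hq2
  have hxn := E.pow_mem hx n
  have hyn := E.pow_mem hy q.den
  have hz := E.mul_mem hxn (E.inv_mem hyn)
  have hτz : τ (x ^ n * (y ^ q.den)⁻¹) = n * τ x - q.den * τ y := by
    rw [hE.additive _ hxn _ (E.inv_mem hyn), hE.additive.map_inv hyn, hE.additive.map_pow hx,
      hE.additive.map_pow hy]
    ring
  have hφz : φ (τ (x ^ n * (y ^ q.den)⁻¹)) = -q.den := by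
    rw [hτz, ← nsmul_eq_mul, ← nsmul_eq_mul, map_sub, map_nsmul, map_nsmul, hφx, hφy]
    simp
  have h1 := hpos _ hz (hE.one_lt_of_pos hz (by rw [hτz]; linarith))
  rw [hφz, hτz] at h1
  linarith

theorem exists_pow_eq (h : r.IsIsolatedBy C T) {E : Subgroup G} {τ : G → ℝ}
    (hE : r.IsLevel E τ) {x y : G} (hx : x ∈ E) (hy : y ∈ E) (hx0 : 0 < τ x) (hy0 : 0 < τ y) :
    ∃ a b : ℕ, 0 < a ∧ 0 < b ∧ ∃ d ∈ hE.additive.ker, x ^ a = y ^ b * d := by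
  obtain ⟨a, b, ha, hb, hab⟩ := h.exists_commensurable hE hx hy hx0 hy0
  have hyb := E.pow_mem hy b
  have hxa := E.pow_mem hx a
  refine ⟨a, b, ha, hb, (y ^ b)⁻¹ * x ^ a, ⟨E.mul_mem (E.inv_mem hyb) hxa, ?_⟩, by group⟩
  rw [hE.additive _ (E.inv_mem hyb) _ hxa, hE.additive.map_inv hyb, hE.additive.map_pow hx,
    hE.additive.map_pow hy]
  linarith

/-- `E / ker τ` has rational rank one and convex subgroups are closed under roots, so no `s`-convex
subgroup containing `ker τ` meets `E` strictly between the two. -/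
theorem le_of_ker_le (h : r.IsIsolatedBy C T) {E : Subgroup G} {τ : G → ℝ}
    (hE : r.IsLevel E τ) {s : LeftPreorder G} {D : Subgroup G} (hD : s.IsConvex D)
    (hker : hE.additive.ker ≤ D) {y : G} (hy : y ∈ E) (hyD : y ∈ D) (hy0 : τ y ≠ 0) : E ≤ D := by
  have key : ∀ y ∈ E, y ∈ D → 0 < τ y → ∀ x ∈ E, 0 < τ x → x ∈ D := by
    intro y hy hyD hy0 x hx hx0
    obtain ⟨a, b, ha, -, d, hd, hxa⟩ := h.exists_pow_eq hE hx hy hx0 hy0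
    refine hD.of_pow_mem ha.ne' ?_
    rw [hxa]
    exact D.mul_mem (D.pow_mem hyD b) (hker hd)
  obtain ⟨y', hy', hyD', hy0'⟩ : ∃ y ∈ E, y ∈ D ∧ 0 < τ y := by
    rcases hy0.lt_or_gt with h0 | h0
    · exact ⟨y⁻¹, E.inv_mem hy, D.inv_mem hyD, by rw [hE.additive.map_inv hy]; linarith⟩
    · exact ⟨y, hy, hyD, h0⟩
  intro x hx
  rcases lt_trichotomy (τ x) 0 with h0 | h0 | h0
  · rw [← inv_mem_iff]
    exact key y' hy' hyD' hy0' _ (E.inv_mem hx) (by rw [hE.additive.map_inv hx]; linarith)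
  · exact hker ⟨hx, h0⟩
  · exact key y' hy' hyD' hy0' x hx h0

/-- The kernel of a principal level is either contained in `C` or is itself the group of a
principal level. -/
theorem exists_ker_eq (h : r.IsIsolatedBy C T) {E : Subgroup G} {τ : G → ℝ}
    (hE : r.IsLevel E τ) (hker : ¬ hE.additive.ker ≤ C) :
    ∃ u ∈ T, ∃ η, r.IsPrincipalLevel u hE.additive.ker η := by
  classical
  have hconv := hE.isConvex_ker
  have hCker := hconv.le h.mem.1
  -- The level of `x` itself contains an element of `T`; hence powers of the largest element of `T`
  -- in the kernel are cofinal there.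
  have key : ∀ x ∈ hE.additive.ker, r.lt 1 x →
      ∃ u ∈ T, u ∈ hE.additive.ker ∧ ∃ n : ℕ, r.le x (u ^ n) := by
    intro x hx hx1
    obtain ⟨X, ξ, hX⟩ := exists_isPrincipalLevel h.mem.2 hx1
    obtain ⟨u, huT, huX, hu0⟩ := h.exists_mem_pos hX.toIsLevel hX.mem hX.pos
    exact ⟨u, huT, hX.le_of_mem hconv hx huX, hX.exists_le_pow huX hX.mem hu0⟩
  obtain ⟨k, hk, hkC⟩ := SetLike.not_le_iff_exists.1 hker
  obtain ⟨u₀, hu₀T, hu₀⟩ : ∃ u ∈ T, u ∈ hE.additive.ker := by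
    rcases r.trichotomy h.mem.1 k with h1 | h1 | h1
    · obtain ⟨u, hu, hu', -⟩ := key k hk h1
      exact ⟨u, hu, hu'⟩
    · exact absurd h1 hkC
    · obtain ⟨u, hu, hu', -⟩ := key k⁻¹ (inv_mem hk) h1
      exact ⟨u, hu, hu'⟩
  obtain ⟨v, hvT, hv, hmax⟩ : ∃ v ∈ T, v ∈ hE.additive.ker ∧
      ∀ u ∈ T, u ∈ hE.additive.ker → r.le u v := by
    let _ := r.toPreorder
    obtain ⟨v, hv⟩ := (T.filter (· ∈ hE.additive.ker)).exists_maximal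
      ⟨u₀, Finset.mem_filter.2 ⟨hu₀T, hu₀⟩⟩
    obtain ⟨hvT, hv'⟩ := Finset.mem_filter.1 hv.prop
    exact ⟨v, hvT, hv', fun u hu hu' => (r.total u v).elim id fun hvu =>
      hv.le_of_ge (Finset.mem_filter.2 ⟨hu, hu'⟩) hvu⟩
  obtain ⟨H, η, hH⟩ := exists_isPrincipalLevel h.mem.2 (h.pos v hvT)
  have hpos : ∀ x ∈ hE.additive.ker, r.lt 1 x → x ∈ H := by
    intro x hx hx1
    obtain ⟨u, huT, hu, n, hn⟩ := key x hx hx1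
    have huH := hH.convex u v (h.pos u huT).1 (hmax u huT hu) hH.mem
    exact hH.convex _ _ hx1.1 hn (H.pow_mem huH n)
  have hHker : H = hE.additive.ker := by
    refine le_antisymm (hH.le_of_mem hconv hv) fun x hx => ?_
    rcases r.trichotomy h.mem.1 x with h1 | h1 | h1
    · exact hpos x hx h1
    · exact hH.convex.le h.mem.1 h1
    · rw [← inv_mem_iff]
      exact hpos _ (inv_mem hx) h1
  exact ⟨v, hvT, η, hHker ▸ hH⟩

/-- The kernels of the levels of an isolated preorder are convex for every other preorder. -/
theorem lt_of_mem_ker (h : r.IsIsolatedBy C T) {s : LeftPreorder G} (hs : s ∈ Cord C) {t : G}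
    {E : Subgroup G} {τ : G → ℝ} (hE : r.IsPrincipalLevel t E τ) {x k : G} (hx : x ∈ E)
    (hx0 : τ x ≠ 0) (hx1 : s.le 1 x) (hk : k ∈ hE.additive.ker) : s.lt k x := by
  classical
  -- Descending to the level `(ker τ, η)` of `u` drops `u` from the count, since `η u > 0`.
  induction hn : (T.filter (· ∈ hE.additive.ker)).card using Nat.strong_induction_on
    generalizing t E τ x k with
  | _ n ih =>
  have hxC : x ∉ C := fun hxC => hx0 (hE.eq_zero_of_mem h.mem.1 hxC)
  refine s.lt_of_not_le fun hxk => ?_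
  by_cases hker : hE.additive.ker ≤ C
  · exact hxC ((s.mem_iff hs.1).2 ⟨hx1, s.trans _ _ _ hxk ((s.mem_iff hs.1).1 (hker hk)).2⟩)
  obtain ⟨u, huT, η, hH⟩ := h.exists_ker_eq hE.toIsLevel hker
  have hcard : (T.filter (· ∈ hH.additive.ker)).card < n := by
    rw [← hn]
    refine Finset.card_lt_card ⟨fun y hy => ?_, fun hsub => ?_⟩
    · rw [Finset.mem_filter] at hy ⊢
      exact ⟨hy.1, hy.2.1⟩
    · have := (Finset.mem_filter.1 (hsub (Finset.mem_filter.2 ⟨huT, hH.mem⟩))).2.2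
      exact hH.pos.ne' this
  have huC : u ∉ C := r.not_mem_of_one_lt h.mem.1 (h.pos u huT)
  obtain ⟨u', hu', hu'0, hu'1, hu'u⟩ : ∃ u' ∈ hE.additive.ker, η u' ≠ 0 ∧ s.lt 1 u' ∧
      ∀ F : Subgroup G, u' ∈ F ↔ u ∈ F := by
    rcases s.trichotomy hs.1 u with h1 | h1 | h1
    · exact ⟨u, hH.mem, hH.pos.ne', h1, fun _ => Iff.rfl⟩
    · exact absurd h1 huC
    · refine ⟨u⁻¹, inv_mem hH.mem, ?_, h1, fun F => inv_mem_iff⟩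
      rw [hH.additive.map_inv hH.mem]
      exact neg_ne_zero.2 hH.pos.ne'
  obtain ⟨F, ω, hF⟩ := exists_isPrincipalLevel hs.2 hu'1
  have huF := (hu'u F).1 hF.mem
  have hωu : ω u ≠ 0 := fun h0 => hF.pos.ne' ((hu'u hF.additive.ker).2 ⟨huF, h0⟩).2
  -- By induction `ker η` is negligible against `u'` for `s`. If `x` is not above `ker τ`, convexity
  -- then puts all of `E` inside the `s`-level `F` of `u'`, so `ω` is defined on `E`.
  have hkerη : hH.additive.ker ≤ hF.additive.ker := hF.le_ker_of_forall_le hF.mem fun e he =>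
    (ih _ hcard hH hu' hu'0 hu'1.1 he rfl).1
  have hKF : hE.additive.ker ≤ F := h.le_of_ker_le hH.toIsLevel hF.convex
    (fun d hd => (hkerη hd).1) hH.mem huF hH.pos.ne'
  have hEF : E ≤ F := h.le_of_ker_le hE.toIsLevel hF.convex hKF hx
    (hF.convex x k hx1 hxk (hKF hk)) hx0
  -- The factor `ω u` corrects the sign, as `u` may be `s`-negative; by rank one, `ω` on `ker τ` is
  -- then a nonnegative multiple of `η`.
  obtain ⟨ε, hε, hpos⟩ := h.exists_perturbation hE.toIsLevel (θ := fun z => ω u * ω z)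
    (fun a ha b hb => by simp only [hF.additive a (hEF ha) b (hEF hb)]; ring)
    (fun c hc => by rw [hF.eq_zero_of_mem hs.1 hc, mul_zero])
    (fun a haT haE ha0 => by
      have haK : a ∈ hE.additive.ker := ⟨haE, ha0⟩
      rcases (hH.nonneg a haK (h.pos a haT).1).eq_or_lt with h0 | h0
      · rw [(hkerη ⟨haK, h0.symm⟩).2, mul_zero]
      · obtain ⟨m, l, hm, hl, d, hd, hmul⟩ := h.exists_pow_eq hH.toIsLevel haK hH.mem h0 hH.pos
        have h1 : m * ω a = l * ω u := by
          rw [← hF.additive.map_pow (hEF haE), hmul,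
            hF.additive _ (F.pow_mem huF l) _ (hkerη hd).1, (hkerη hd).2,
            hF.additive.map_pow huF, add_zero]
        have hm' : (0 : ℝ) < m := by exact_mod_cast hm
        refine nonneg_of_mul_nonneg_right (a := (m : ℝ)) ?_ hm'
        rw [mul_left_comm, h1]
        have : 0 ≤ (l : ℝ) * (ω u * ω u) := mul_nonneg l.cast_nonneg (mul_self_nonneg _)
        linarith)
  have hθu : 0 < ε * (ω u * ω u) := mul_pos hε (mul_self_pos.2 hωu)
  -- For large `q`, `t * (u ^ q)⁻¹` is `r`-positive because `τ u = 0`, yet `τ + ε θ` is negative on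
  -- it.
  obtain ⟨q, hq⟩ := exists_nat_gt ((τ t + ε * (ω u * ω t)) / (ε * (ω u * ω u)))
  rw [div_lt_iff₀ hθu] at hq
  have huE : u ∈ E := hH.mem.1
  have huq := E.pow_mem huE q
  have hz : t * (u ^ q)⁻¹ ∈ E := E.mul_mem hE.mem (E.inv_mem huq)
  have hτz : τ (t * (u ^ q)⁻¹) = τ t := by
    rw [hE.additive _ hE.mem _ (E.inv_mem huq), hE.additive.map_inv huq,
      hE.additive.map_pow huE, hH.mem.2]
    ring
  have hωz : ω (t * (u ^ q)⁻¹) = ω t - q * ω u := by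
    rw [hF.additive _ (hEF hE.mem) _ (hEF (E.inv_mem huq)), hF.additive.map_inv (hEF huq),
      hF.additive.map_pow huF]
    ring
  have h1 := hpos _ hz (hE.one_lt_of_pos hz (by rw [hτz]; exact hE.pos))
  rw [hτz, hωz] at h1
  nlinarith

/-- Some `t ∈ T` generates the same level as `x`, so `x ^ a = t ^ b * d` with `d` in the kernel, and
`d` is negligible for every `s` by `lt_of_mem_ker`. -/
theorem exists_one_lt_iff (h : r.IsIsolatedBy C T) {x : G} (hx : r.lt 1 x) :
    ∃ t ∈ T, ∀ s ∈ Cord C, s.lt 1 t ↔ s.lt 1 x := by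
  obtain ⟨X, ξ, hX⟩ := exists_isPrincipalLevel h.mem.2 hx
  obtain ⟨t, htT, htX, ht0⟩ := h.exists_mem_pos hX.toIsLevel hX.mem hX.pos
  obtain ⟨E, τ, hE⟩ := exists_isPrincipalLevel h.mem.2 (h.pos t htT)
  have hxE : x ∈ E := by
    obtain ⟨n, hn⟩ := hX.exists_le_pow htX hX.mem ht0
    exact hE.convex _ _ hx.1 hn (E.pow_mem hE.mem n)
  have hx0 : 0 < τ x := by
    obtain ⟨n, hn⟩ := hX.cofinal t htX
    have h1 := hE.mono hE.mem (E.pow_mem hxE n) hn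
    rw [hE.additive.map_pow hxE] at h1
    exact pos_of_mul_pos_right (hE.pos.trans_le h1) n.cast_nonneg
  obtain ⟨a, b, ha, hb, d, hd, hxa⟩ := h.exists_pow_eq hE.toIsLevel hxE hE.mem hx0 hE.pos
  have htb := E.pow_mem hE.mem b
  have htb0 : τ (t ^ b) ≠ 0 := by
    rw [hE.additive.map_pow hE.mem]
    have : (0 : ℝ) < b := by exact_mod_cast hb
    exact (mul_pos this hE.pos).ne'
  refine ⟨t, htT, fun s hs => ⟨fun ht => ?_, fun hx1 => ?_⟩⟩
  · refine s.lt_of_not_le fun hle => ?_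
    have h1 := s.pow_le_one hle a
    rw [hxa] at h1
    have h2 : s.le 1 (d⁻¹ * (t ^ b)⁻¹) := by
      rw [← mul_inv_rev]
      exact s.one_le_inv.2 h1
    have h3 : s.le (d⁻¹ * (t ^ b)⁻¹) d⁻¹ := by
      simpa using s.left_invariant d⁻¹ _ _ (s.inv_le_one.2 (s.one_le_pow ht.1 b))
    refine (h.lt_of_mem_ker hs hE (E.mul_mem (E.inv_mem hd.1) (E.inv_mem htb)) ?_ h2
      (inv_mem hd)).2 h3
    rw [hE.additive _ (E.inv_mem hd.1) _ (E.inv_mem htb), hE.additive.map_inv hd.1,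
      hE.additive.map_inv htb, hd.2, neg_zero, zero_add]
    exact neg_ne_zero.2 htb0
  · refine ((s.trichotomy hs.1 t).resolve_right ?_)
    rintro (ht | ht)
    · exact r.not_mem_of_one_lt h.mem.1 (h.pos t htT) ht
    · have h1 := s.one_le_pow hx1.1 a
      rw [hxa] at h1
      have h2 : s.le (t ^ b)⁻¹ d := by simpa using s.left_invariant (t ^ b)⁻¹ _ _ h1
      have h3 : s.le 1 (t ^ b)⁻¹ := by
        rw [← inv_pow]
        exact s.one_le_pow ht.1 b
      refine (h.lt_of_mem_ker hs hE (E.inv_mem htb) ?_ h3 hd).2 h2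
      rw [hE.additive.map_inv htb]
      exact neg_ne_zero.2 htb0

theorem finite (h : r.IsIsolatedBy C T) : Finite (Cord C) := by
  refine Finite.of_injective (β := Set T) (fun s => {t | s.1.lt 1 t}) fun s s' hss' => ?_
  have hT : ∀ t ∈ T, s.1.lt 1 t ↔ s'.1.lt 1 t := fun t ht => by
    have := Set.ext_iff.1 hss' ⟨t, ht⟩
    simpa using this
  have hpos : ∀ x, r.lt 1 x → (s.1.lt 1 x ↔ s'.1.lt 1 x) := fun x hx => by
    obtain ⟨t, ht, hiff⟩ := h.exists_one_lt_iff hx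
    rw [← hiff _ s.2, ← hiff _ s'.2, hT t ht]
  have hinv : ∀ s ∈ Cord C, ∀ x ∉ C, (s.lt 1 x ↔ ¬ s.lt 1 x⁻¹) := fun s hs x hx => by
    have := s.trichotomy hs.1 x
    have := fun h : s.lt 1 x⁻¹ => s.not_one_lt_of_one_lt_inv h
    tauto
  refine Subtype.ext (ext_of_one_lt fun x => ?_)
  rcases r.trichotomy h.mem.1 x with hx | hx | hx
  · exact hpos x hx
  · have h1 := fun h : s.1.lt 1 x => s.1.not_mem_of_one_lt s.2.1 h hx
    have h2 := fun h : s'.1.lt 1 x => s'.1.not_mem_of_one_lt s'.2.1 h hx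
    tauto
  · have hxC : x ∉ C := fun hxC => r.not_mem_of_one_lt h.mem.1 hx (C.inv_mem hxC)
    rw [hinv _ s.2 x hxC, hinv _ s'.2 x hxC, hpos _ hx]

end IsIsolatedBy

end LeftPreorder

/-! ### Compactness, and isolation by finitely many signs. -/

namespace LeftPreorder

variable {G : Type*} [Group G]

theorem signMap_eq_neg_one_iff (r : LeftPreorder G) (g : G) :
    r.signMap g = -1 ↔ r.lt 1 g⁻¹ := by
  unfold signMap positiveCone
  by_cases h : r.lt 1 g
  · simp only [Set.mem_ofPred_eq, h, if_true]
    exact ⟨fun h' => absurd h' (by decide), fun h' => absurd h (r.not_one_lt_of_one_lt_inv h')⟩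
  · by_cases h2 : r.lt 1 g⁻¹ <;> simp [h, h2]

theorem signMap_eq_zero_iff (r : LeftPreorder G) {C : Subgroup G} (hr : r.IsRelativeTo C) (g : G) :
    r.signMap g = 0 ↔ g ∈ C := by
  have h1 := r.signMap_eq_one_iff g
  have h2 := r.signMap_eq_neg_one_iff g
  have h3 := r.trichotomy hr g
  have h4 : r.lt 1 g → g ∉ C := r.not_mem_of_one_lt hr
  have h5 : r.lt 1 g⁻¹ → g ∉ C := fun h hg => r.not_mem_of_one_lt hr h (C.inv_mem hg)
  cases h : r.signMap g <;> simp_all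

theorem exists_isIsolatedBy {C : Subgroup G} (hC : C ≠ ⊤) {r : Cord C}
    (hr : IsOpen ({r} : Set (Cord C))) : ∃ T, r.1.IsIsolatedBy C T := by
  classical
  obtain ⟨V, hV, hrV⟩ := isOpen_induced_iff.1 hr
  obtain ⟨U, hU, rfl⟩ := isOpen_induced_iff.1 hV
  have hrU : r.1.signMap ∈ U := by
    have : r ∈ ({r} : Set (Cord C)) := rfl
    rwa [← hrV] at this
  obtain ⟨I, u, hu, hIU⟩ := isOpen_pi_iff.1 hU _ hrU
  -- A negative coordinate is recorded by its positive inverse; zero coordinates are fixed by `C`.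
  refine ⟨(I ∪ I.image (·⁻¹)).filter (r.1.lt 1), hC, r.2, fun t ht => (Finset.mem_filter.1 ht).2,
    fun s hs hsT => ?_⟩
  have hsU : s.signMap ∈ U := by
    refine hIU fun a ha => ?_
    have hau := (hu a ha).2
    have : s.signMap a = r.1.signMap a := by
      rcases r.1.trichotomy r.2.1 a with h | h | h
      · rw [(r.1.signMap_eq_one_iff a).2 h, signMap_eq_one_iff]
        exact hsT a (Finset.mem_filter.2 ⟨Finset.mem_union_left _ ha, h⟩)
      · rw [(r.1.signMap_eq_zero_iff r.2.1 a).2 h, s.signMap_eq_zero_iff hs.1]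
        exact h
      · rw [(r.1.signMap_eq_neg_one_iff a).2 h, signMap_eq_neg_one_iff]
        exact hsT _ (Finset.mem_filter.2
          ⟨Finset.mem_union_right _ (Finset.mem_image_of_mem _ ha), h⟩)
    rwa [this]
  have : (⟨s, hs⟩ : Cord C) ∈ ({r} : Set (Cord C)) := by
    rw [← hrV]
    exact hsU
  exact congrArg Subtype.val this

/-- With the exponent fixed at `2`, each condition involves finitely many coordinates, so the image
is closed. -/
theorem image_signMap_cord {C : Subgroup G} (hC : C ≠ ⊤) :
    signMap '' Cord C = {f : G → SignType | (∀ g, f g = 0 ↔ g ∈ C) ∧ (∀ g, f g⁻¹ = -f g) ∧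
      (∀ a b, f a = 1 → f b = 1 → f (a * b) = 1) ∧
      ∀ a b, f a = 1 → f b = 1 → f (a⁻¹ * (b * a ^ 2)) = 1} := by
  ext f
  constructor
  · rintro ⟨r, ⟨hrC, hrc⟩, rfl⟩
    refine ⟨r.signMap_eq_zero_iff hrC, fun g => ?_, fun a b => ?_, fun a b => ?_⟩
    · rcases r.trichotomy hrC g with h | h | h
      · rw [(r.signMap_eq_one_iff g).2 h, signMap_eq_neg_one_iff, inv_inv]
        exact h
      · rw [(r.signMap_eq_zero_iff hrC g).2 h, neg_zero, r.signMap_eq_zero_iff hrC]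
        exact C.inv_mem h
      · rw [(r.signMap_eq_neg_one_iff g).2 h, neg_neg, signMap_eq_one_iff]
        exact h
    · simp only [signMap_eq_one_iff]
      exact r.one_lt_mul
    · simp only [signMap_eq_one_iff, one_lt_inv_mul]
      exact r.isConradian_iff_sq.1 hrc a b
  · rintro ⟨h0, hinv, hmul, hconr⟩
    obtain ⟨r, hr, hrC⟩ := exists_one_lt_iff_of_cone hC {g | f g = 1} (fun a ha b hb => hmul a b ha hb)
      (fun a ha haC => by
        rw [Set.mem_ofPred_eq, (h0 a).2 haC] at ha
        exact absurd ha (by decide))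
      (fun a => by
        simp only [Set.mem_ofPred_eq, ← h0, hinv]
        generalize f a = i
        revert i
        decide)
    refine ⟨r, ⟨hrC, r.isConradian_iff_sq.2 fun a b ha hb => ?_⟩, funext fun g => ?_⟩
    · rw [← one_lt_inv_mul]
      rw [hr] at ha hb ⊢
      exact hconr a b ha hb
    · have h1 := (r.signMap_eq_one_iff g).trans (hr g)
      have h2 := (r.signMap_eq_neg_one_iff g).trans (hr g⁻¹)
      simp only [Set.mem_ofPred_eq, hinv] at h1 h2
      generalize r.signMap g = i at h1 h2
      generalize f g = j at h1 h2
      revert i j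
      decide

theorem isCompact_cord {C : Subgroup G} (hC : C ≠ ⊤) : IsCompact (Cord C) := by
  have hind : Topology.IsInducing (signMap : LeftPreorder G → G → SignType) := ⟨rfl⟩
  rw [hind.isCompact_iff, image_signMap_cord hC]
  have hclopen : ∀ (g : G) (S : Set SignType), IsClopen {f : G → SignType | f g ∈ S} :=
    fun g S => (isClopen_discrete S).preimage (continuous_apply g)
  have himp : ∀ a b c : G, IsClosed {f : G → SignType | f a = 1 → f b = 1 → f c = 1} :=
    fun a b c => isClosed_imp (hclopen a {1}).isOpen
      (isClosed_imp (hclopen b {1}).isOpen (hclopen c {1}).isClosed)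
  refine IsClosed.isCompact ?_
  simp only [Set.ofPred_and, Set.ofPred_forall]
  refine IsClosed.inter (isClosed_iInter fun g => ?_) (IsClosed.inter (isClosed_iInter fun g => ?_)
    (IsClosed.inter (isClosed_iInter fun a => isClosed_iInter fun b => himp _ _ _)
      (isClosed_iInter fun a => isClosed_iInter fun b => himp _ _ _)))
  · by_cases hg : g ∈ C
    · simpa [hg] using (hclopen g {0}).isClosed
    · simpa [hg] using (hclopen g {0}ᶜ).isClosed
  · exact isClosed_eq (continuous_apply _) (continuous_of_discreteTopology.comp (continuous_apply g))

instance : T2Space (LeftPreorder G) :=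
  T2Space.of_injective_continuous signMap_injective continuous_induced_dom

end LeftPreorder

/-! ### Baire category and the conclusion. -/

theorem uncountable_of_forall_not_isOpen_singleton {X : Type*} [TopologicalSpace X] [BaireSpace X]
    [T1Space X] [Nonempty X] (h : ∀ x : X, ¬ IsOpen ({x} : Set X)) : Uncountable X := by
  by_contra hc
  rw [not_uncountable_iff] at hc
  obtain ⟨x, y, hy⟩ := nonempty_interior_of_iUnion_of_closed (f := fun x : X => ({x} : Set X))
    (fun _ => isClosed_singleton) (Set.iUnion_of_singleton X)
  refine h x ?_
  have : interior {x} = ({x} : Set X) :=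
    interior_subset.antisymm (Set.singleton_subset_iff.2 (interior_subset hy ▸ hy))
  rw [← this]
  exact isOpen_interior

theorem mainTheorem4 {G : Type*} [Group G] (C : Subgroup G) (hC : C ≠ ⊤) :
    (Finite (Cord C) ∨ Uncountable (Cord C)) ∧
      (Infinite (Cord C) →
        Nonempty (Cord C) ∧ CompactSpace (Cord C) ∧ T2Space (Cord C) ∧
          ∀ r : Cord C, ¬ IsOpen ({r} : Set (Cord C))) := by
  have hcompact : CompactSpace (Cord C) :=
    isCompact_iff_compactSpace.1 (LeftPreorder.isCompact_cord hC)
  have hopen : Infinite (Cord C) → ∀ r : Cord C, ¬ IsOpen ({r} : Set (Cord C)) := by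
    intro hinf r hr
    obtain ⟨T, hT⟩ := LeftPreorder.exists_isIsolatedBy hC hr
    exact not_finite_iff_infinite.2 hinf hT.finite
  refine ⟨?_, fun hinf => ⟨Infinite.nonempty _, hcompact, inferInstance, hopen hinf⟩⟩
  rcases finite_or_infinite (Cord C) with hfin | hinf
  · exact .inl hfin
  · have := Infinite.nonempty (Cord C)
    exact .inr (uncountable_of_forall_not_isOpen_singleton (hopen hinf))
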